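/- Let $G$ be a countable discrete group and let $\Sigma=(\sigma_n)_{n\ge1}$ be a sofic approximation to $G$, i.e. maps $\sigma_n:G\to\mathrm{Sym}(V_n)$, $V_n$ nonempty finite sets, such that $\sigma_n^g\sigma_n^h(v)=\sigma_n^{gh}(v)$ for a proportion of $v\in V_n$ tending to $1$, for all $g,h\in G$, and $\sigma_n^g(v)\neq v$ for a proportion of $v\in V_n$ tending to $1$, for all $g\ne e$. A $G$-process $(\mathcal X^G,\mu,S)$ consists of a standard measurable space $\mathcal X$ and a probability measure $\mu$ on $\mathcal X^G$ invariant under the right shift $S^g((x_h)_h)=(x_{hg})_h$. It becomes a metric $G$-process with a compact generating metric $d$ on $\mathcal X$ (a compact metric whose Borel $\sigma$-algebra is that of $\mathcal X$); then $\mathcal X^G$ has the product topology and $\Pr(\mathcal X^G)$ the weak$^*$ topology. For $\mathbf x\in\mathcal X^{V_n}$ and $v\in V_n$ put $\Pi^{\sigma_n}_v(\mathbf x)=(x_{\sigma_n^g(v)})_{g\in G}$, $P^{\sigma_n}_{\mathbf x}=\frac1{|V_n|}\sum_{v}\delta_{\Pi_v^{\sigma_n}(\mathbf x)}$, and $d^{(V_n)}(\mathbf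 x,\mathbf x')=\frac1{|V_n|}\sum_v d(x_v,x'_v)$. Measures $\mu_n\in\Pr(\mathcal X^{V_n})$ *quenched-converge* to $\mu$ over $\Sigma$, $\mu_n\stackrel{\mathrm q}{\to}\mu$, if for every weak$^*$-neighbourhood $\mathcal O$ of $\mu$ the proportion of $v\in V_n$ with $(\Pi^{\sigma_n}_v)_*\mu_n\in\mathcal O$ tends to $1$ and $\mu_n\{\mathbf x: P^{\sigma_n}_{\mathbf x}\in\mathcal O\}\to1$. They *doubly-quenched-converge*, $\mu_n\stackrel{\mathrm{dq}}{\to}\mu$, if $\mu_n\times\mu_n\stackrel{\mathrm q}{\to}\mu\times\mu$, regarded as measures on $(\mathcal X\times\mathcal X)^{V_n}$ and $(\mathcal X\times\mathcal X)^G$. Let $\mathrm{cov}_{\varepsilon,\delta}(\nu,\rho)$ be the minimum of $|F|$ over sets $F$ whose $\delta$-neighbourhood in the metric $\rho$ has $\nu$-measure $>1-\varepsilon$. For $\ast\in\{\mathrm q,\mathrm{dq}\}$ define, with values in $[-\infty,+\infty]$ and $\sup\emptyset=-\infty$, $$\mathrm h^{\ast}_\Sigma(\mu)=\sup\Big\{\sup_{\delta,\varepsilon>0}\limsup_{i\to\infty}\frac1{|V_{n_i}|}\log\mathrm{cov}_{\varepsilon,\delta}\big(\mu_i,d^{(V_{n_i})}\big):\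 n_i\uparrow\infty,\ \mu_i\in\Pr(\mathcal X^{V_{n_i}}),\ \mu_i\stackrel{\ast}{\to}\mu\text{ over }(\sigma_{n_i})_{i\ge1}\Big\}.$$ **Theorem.** For the fixed sofic approximation $\Sigma$, the quantities $\mathrm h^{\mathrm q}_\Sigma(\mu)$ and $\mathrm h^{\mathrm{dq}}_\Sigma(\mu)$ are isomorphism invariants of the metric $G$-process $(\mathcal X^G,\mu,S,d)$: if $(\mathcal X^G,\mu,S,d_{\mathcal X})$ and $(\mathcal Y^G,\nu,S,d_{\mathcal Y})$ are metric $G$-processes such that $(\mathcal X^G,\mu,S)$ and $(\mathcal Y^G,\nu,S)$ are measure-theoretically isomorphic $G$-systems, then $\mathrm h^{\mathrm q}_\Sigma(\mu)=\mathrm h^{\mathrm q}_\Sigma(\nu)$ and $\mathrm h^{\mathrm{dq}}_\Sigma(\mu)=\mathrm h^{\mathrm{dq}}_\Sigma(\nu)$. In particular, neither quantity depends on the choice of the compact generating metric $d$. -/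

import Mathlib

open Filter Topology MeasureTheory
open scoped ENNReal

noncomputable section

/-! ### Sofic approximations -/

/-- The property `P n v` holds with high probability in a uniformly random `v ∈ V n`,
as `n → ∞`. -/
def WithHighProbability {V : ℕ → Type*} [∀ n, Fintype (V n)] (P : ∀ n, V n → Prop) : Prop :=
  Tendsto (fun n => ({v | P n v}.ncard : ℝ) / (Fintype.card (V n) : ℝ)) atTop (𝓝 1)

/-- A sofic approximation to `G`: nonempty finite sets `V n` and (arbitrary) maps
`σ n : G → Sym (V n)` which are asymptotically multiplicative and asymptotically free. -/
structure SoficApproximation (G : Type*) [Group G] where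
  V : ℕ → Type*
  instFintype : ∀ n, Fintype (V n)
  instNonempty : ∀ n, Nonempty (V n)
  σ : ∀ n, G → Equiv.Perm (V n)
  mul_whp : ∀ g h : G, WithHighProbability fun n v => σ n g (σ n h v) = σ n (g * h) v
  free_whp : ∀ g : G, g ≠ 1 → WithHighProbability fun n v => σ n g v ≠ v

attribute [instance] SoficApproximation.instFintype SoficApproximation.instNonempty

/-- The sofic sub-approximation `(σ_{n_i})_i`. -/
def SoficApproximation.sub {G : Type*} [Group G] (S : SoficApproximation G)
    (n : ℕ → ℕ) (hn : StrictMono n) : SoficApproximation G where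
  V i := S.V (n i)
  instFintype i := S.instFintype (n i)
  instNonempty i := S.instNonempty (n i)
  σ i := S.σ (n i)
  mul_whp g h := (S.mul_whp g h).comp hn.tendsto_atTop
  free_whp g hg := (S.free_whp g hg).comp hn.tendsto_atTop

/-! ### Processes and isomorphisms -/

/-- The right-shift action of `G` on `X^G`: `(S^g x)_h = x_{hg}`. -/
def rightShift {G X : Type*} [Group G] (g : G) (x : G → X) : G → X :=
  fun h => x (h * g)

/-- `(X^G, μ, S)` is a `G`-process: `μ` is invariant under the right shift. -/
def IsGProcess {G X : Type*} [Group G] [MeasurableSpace X]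
    (μ : ProbabilityMeasure (G → X)) : Prop :=
  ∀ g : G, MeasurePreserving (rightShift g) (μ : Measure (G → X)) (μ : Measure (G → X))

/-- Measure-theoretic isomorphism of the `G`-systems `(A, μ, T)` and `(B, ν, T')`: there are
measure-preserving maps in both directions which are inverse to each other almost everywhere
and intertwine the actions almost everywhere. -/
def SystemsIsomorphic {G A B : Type*} [MeasurableSpace A] [MeasurableSpace B]
    (μ : Measure A) (T : G → A → A) (ν : Measure B) (T' : G → B → B) : Prop :=
  ∃ (Φ : A → B) (Ψ : B → A),
    MeasurePreserving Φ μ ν ∧ MeasurePreserving Ψ ν μ ∧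
    (∀ᵐ x ∂μ, Ψ (Φ x) = x) ∧ (∀ᵐ y ∂ν, Φ (Ψ y) = y) ∧
    ∀ g : G, ∀ᵐ x ∂μ, Φ (T g x) = T' g (Φ x)

/-- Isomorphism of the `G`-processes `(X^G, μ, S)` and `(Y^G, ν, S)`. -/
def ProcessesIsomorphic {G X Y : Type*} [Group G] [MeasurableSpace X] [MeasurableSpace Y]
    (μ : ProbabilityMeasure (G → X)) (ν : ProbabilityMeasure (G → Y)) : Prop :=
  SystemsIsomorphic (G := G) (μ : Measure (G → X)) rightShift (ν : Measure (G → Y)) rightShift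

/-! ### Pullback names, empirical distributions, good models -/

section Names

variable {G V X : Type*}

/-- The pullback name `Π^σ_v(x) = (x_{σ^g(v)})_{g ∈ G}`. -/
def pullbackName (σ : G → Equiv.Perm V) (v : V) (x : V → X) : G → X :=
  fun g => x (σ g v)

theorem measurable_pullbackName [MeasurableSpace X] (σ : G → Equiv.Perm V) (v : V) :
    Measurable (pullbackName (X := X) σ v) :=
  measurable_pi_lambda _ fun g => measurable_pi_apply (σ g v)

/-- The local marginal `(Π^σ_v)_* θ` of a measure `θ` on `X^V`. -/
def localMarginal [MeasurableSpace X] (σ : G → Equiv.Perm V)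
    (θ : ProbabilityMeasure (V → X)) (v : V) : ProbabilityMeasure (G → X) :=
  θ.map (measurable_pullbackName σ v).aemeasurable

/-- The empirical distribution `P^σ_x = |V|⁻¹ ∑_v δ_{Π^σ_v(x)}`. -/
def empiricalDistribution [Fintype V] [Nonempty V] [MeasurableSpace X]
    (σ : G → Equiv.Perm V) (x : V → X) : ProbabilityMeasure (G → X) :=
  ⟨(Fintype.card V : ℝ≥0∞)⁻¹ • ∑ v : V, Measure.dirac (pullbackName σ v x), ⟨by
    simp [ENNReal.inv_mul_cancel]⟩⟩

/-- The set `Ω(O, σ)` of `O`-good models over `σ`. -/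
def goodModels [Fintype V] [Nonempty V] [MeasurableSpace X]
    (O : Set (ProbabilityMeasure (G → X))) (σ : G → Equiv.Perm V) : Set (V → X) :=
  {x | empiricalDistribution σ x ∈ O}

end Names

/-! ### Convergence of measures on model spaces -/

/-- The product `μ × ν`, regarded as a measure on `(X × Y)^I`. -/
def prodOnPairs {I X Y : Type*} [MeasurableSpace X] [MeasurableSpace Y]
    (μ : ProbabilityMeasure (I → X)) (ν : ProbabilityMeasure (I → Y)) :
    ProbabilityMeasure (I → X × Y) :=
  (μ.prod ν).map (f := fun p i => (p.1 i, p.2 i)) (Measurable.aemeasurable (by fun_prop))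

section Convergence

variable {G X : Type*} [Group G] [Countable G] [TopologicalSpace X]
  [SecondCountableTopology X] [MeasurableSpace X] [BorelSpace X]

/-- Local weak* convergence over `S`. Here `𝓝 μ` refers to the weak* topology. -/
def LocalWeakStarConverges (S : SoficApproximation G)
    (μs : ∀ n, ProbabilityMeasure (S.V n → X)) (μ : ProbabilityMeasure (G → X)) : Prop :=
  ∀ O ∈ 𝓝 μ, WithHighProbability fun n v => localMarginal (S.σ n) (μs n) v ∈ O

/-- Quenched convergence over `S`. -/
def QuenchedConverges (S : SoficApproximation G)
    (μs : ∀ n, ProbabilityMeasure (S.V n → X)) (μ : ProbabilityMeasure (G → X)) : Prop :=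
  LocalWeakStarConverges S μs μ ∧
  ∀ O ∈ 𝓝 μ, Tendsto
    (fun n => (μs n : Measure (S.V n → X)) (goodModels O (S.σ n))) atTop (𝓝 1)

/-- Doubly-quenched convergence over `S`. -/
def DoublyQuenchedConverges (S : SoficApproximation G)
    (μs : ∀ n, ProbabilityMeasure (S.V n → X)) (μ : ProbabilityMeasure (G → X)) : Prop :=
  QuenchedConverges S (fun n => prodOnPairs (μs n) (μs n)) (prodOnPairs μ μ)

end Convergence

/-! ### Covering numbers and entropy -/

/-- The Hamming average `d^{(V)}` of the metric of `X` over the finite set `V`. -/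
def hammingAverage {V X : Type*} [Fintype V] [MetricSpace X] (x y : V → X) : ℝ :=
  (∑ v, dist (x v) (y v)) / (Fintype.card V : ℝ)

/-- The covering number of a measure: the minimal `|F|` over sets `F` whose
`δ`-neighbourhood with respect to `ρ` has `ν`-measure greater than `1 - ε`. -/
def covNumber {A : Type*} [MeasurableSpace A] (ε δ : ℝ) (ν : ProbabilityMeasure A)
    (ρ : A → A → ℝ) : ℕ∞ :=
  ⨅ (F : Finset A) (_ : 1 - ε < (ν : Measure A).real {y | ∃ x ∈ F, ρ x y < δ}), (F.card : ℕ∞)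

/-- `sup_{δ,ε>0} limsup_n |V_n|⁻¹ log cov_{ε,δ}(μ_n, d^{(V_n)})`. -/
def coveringGrowth {G X : Type*} [Group G] [MetricSpace X] [MeasurableSpace X]
    (S : SoficApproximation G) (μs : ∀ n, ProbabilityMeasure (S.V n → X)) : EReal :=
  ⨆ (δ : ℝ) (_ : 0 < δ) (ε : ℝ) (_ : 0 < ε),
    limsup (fun n =>
      ENNReal.log (covNumber ε δ (μs n) hammingAverage : ℝ≥0∞) /
        ((Fintype.card (S.V n) : ℝ) : EReal)) atTop

/-- A compact generating metric for the measurable space `X`: a compact metric whose Borel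
`σ`-algebra is the given one. -/
structure CompactGeneratingMetric (X : Type*) [MeasurableSpace X] extends MetricSpace X where
  compactSpace : CompactSpace X
  borelSpace : BorelSpace X

theorem CompactGeneratingMetric.secondCountable {X : Type*} [MeasurableSpace X]
    (d : CompactGeneratingMetric X) :
    letI := d.toMetricSpace
    SecondCountableTopology X :=
  letI := d.toMetricSpace
  haveI := d.compactSpace
  inferInstance

section Entropy

variable {G X : Type*} [Group G] [Countable G] [MeasurableSpace X]

/-- The quenched model-measure sofic entropy of the metric `G`-process `(X^G, μ, S, d)`:
the supremum is over all subsequences `n_i ↑ ∞` and all `μ_i` that quenched-converge to `μ`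
over `(σ_{n_i})_i`; it is `-∞` if there are none. -/
def quenchedEntropy (S : SoficApproximation G) (d : CompactGeneratingMetric X)
    (μ : ProbabilityMeasure (G → X)) : EReal :=
  letI := d.toMetricSpace
  haveI := d.borelSpace
  haveI := d.secondCountable
  ⨆ (n : ℕ → ℕ) (hn : StrictMono n)
    (μs : ∀ i, ProbabilityMeasure ((S.sub n hn).V i → X))
    (_ : QuenchedConverges (S.sub n hn) μs μ), coveringGrowth (S.sub n hn) μs

/-- The doubly-quenched model-measure sofic entropy of `(X^G, μ, S, d)`. -/
def doublyQuenchedEntropy (S : SoficApproximation G) (d : CompactGeneratingMetric X)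
    (μ : ProbabilityMeasure (G → X)) : EReal :=
  letI := d.toMetricSpace
  haveI := d.borelSpace
  haveI := d.secondCountable
  ⨆ (n : ℕ → ℕ) (hn : StrictMono n)
    (μs : ∀ i, ProbabilityMeasure ((S.sub n hn).V i → X))
    (_ : DoublyQuenchedConverges (S.sub n hn) μs μ), coveringGrowth (S.sub n hn) μs

end Entropy

end

/-! The identity coordinate `φ` of an isomorphism `Φ` is only measurable and may depend on
infinitely many coordinates, so it cannot be applied to models directly. It is, however, an almost
everywhere limit of tame maps (`exists_seq_isTame_tendsto_ae`). Applying one tame map at every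
vertex preserves quenched convergence (`QuenchedConverges.modelMap`): its finite window meets only
multiplicative relations at most vertices, and almost everywhere continuity makes push-forward weak*
continuous at `μ`. Choosing a tame map for each `n` diagonally yields models of the image process.

Covering numbers must not drop. To see this, the graph of `Φ` is transported rather than `Φ` alone.
In the limiting measure on `(X × Y)^G` the `X`-coordinate is almost surely a function of the
`Y`-coordinates, because `Φ` is invertible. By compactness, off an event of small measure, finitely
many `Y`-coordinates determine it approximately (`exists_isOpen_approx_dependsOn`). This event stays
small for the empirical distributions of most models, so Hamming-close `Y`-parts force Hamming-close
`X`-parts, and covers on the `Y` side pull back (`QuenchedConverges.coveringGrowth_le`).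

This gives one inequality, and the inverse isomorphism gives the other. The doubly-quenched case
runs the same transport on `μ × μ`, with the same tame map on both factors. -/

/-! ### Tame maps and approximation by them -/

section Tame

/-- Almost every point of `f ⁻¹' U` is interior to it when `U` is open, so the portmanteau
inequality for the open interior suffices. -/
theorem MeasureTheory.ProbabilityMeasure.continuousAt_map_of_ae_continuousAt {A B : Type*}
    [TopologicalSpace A] [TopologicalSpace.PseudoMetrizableSpace A] [SecondCountableTopology A]
    [MeasurableSpace A] [BorelSpace A]
    [TopologicalSpace B] [TopologicalSpace.PseudoMetrizableSpace B] [MeasurableSpace B]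
    [BorelSpace B] {μ : ProbabilityMeasure A} {f : A → B} (hf : Measurable f)
    (hc : ∀ᵐ x ∂(μ : Measure A), ContinuousAt f x) :
    ContinuousAt (fun θ : ProbabilityMeasure A => θ.map hf.aemeasurable) μ := by
  refine tendsto_of_forall_isOpen_le_liminf' fun U hU => ?_
  have key := ProbabilityMeasure.le_liminf_measure_open_of_tendsto (tendsto_id (x := 𝓝 μ))
    (isOpen_interior (s := f ⁻¹' U))
  have h1 : (μ : Measure A) (f ⁻¹' U) ≤ (μ : Measure A) (interior (f ⁻¹' U)) := by
    refine measure_mono_ae ?_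
    filter_upwards [hc] with x hx hxU
    exact mem_interior_iff_mem_nhds.2 (hx (hU.mem_nhds hxU))
  rw [ProbabilityMeasure.map_apply' _ _ hU.measurableSet]
  refine (h1.trans key).trans (liminf_le_liminf (Eventually.of_forall fun θ => ?_))
  rw [ProbabilityMeasure.map_apply' _ _ hU.measurableSet]
  exact measure_mono interior_subset

/-- A measurable map on `X^G` which depends on finitely many coordinates and is continuous at
almost every point. -/
structure IsTame {G X Y : Type*} [TopologicalSpace X] [MeasurableSpace X]
    [TopologicalSpace Y] [MeasurableSpace Y] (μ : Measure (G → X)) (f : (G → X) → Y) : Prop where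
  measurable : Measurable f
  dependsOn : ∃ D : Finset G, DependsOn f (D : Set G)
  continuousAt : ∀ᵐ x ∂μ, ContinuousAt f x

/-- A measurable subset of `X^G` with null boundary which depends on finitely many
coordinates. -/
structure IsTameSet {G X : Type*} [TopologicalSpace X] [MeasurableSpace X]
    (μ : Measure (G → X)) (A : Set (G → X)) : Prop where
  measurableSet : MeasurableSet A
  dependsOn : ∃ D : Finset G, DependsOn (fun x => x ∈ A) (D : Set G)
  frontier : μ (frontier A) = 0

variable {G X : Type*} [TopologicalSpace X] [MeasurableSpace X] {μ : Measure (G → X)}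

theorem isSetAlgebra_isTameSet : IsSetAlgebra {A | IsTameSet μ A} where
  empty_mem := ⟨.empty, ⟨∅, fun _ _ _ => rfl⟩, by simp⟩
  compl_mem A hA := by
    obtain ⟨D, hD⟩ := hA.dependsOn
    exact ⟨hA.measurableSet.compl, ⟨D, fun x y h => congrArg Not (hD h)⟩, by
      rw [frontier_compl]; exact hA.frontier⟩
  union_mem A B hA hB := by
    classical
    obtain ⟨D, hD⟩ := hA.dependsOn
    obtain ⟨E, hE⟩ := hB.dependsOn
    refine ⟨hA.measurableSet.union hB.measurableSet, ⟨D ∪ E, fun x y h => ?_⟩, ?_⟩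
    · exact congrArg₂ Or (hD fun i hi => h i (by simp_all)) (hE fun i hi => h i (by simp_all))
    · refine measure_mono_null (frontier_union_subset A B) (measure_union_null ?_ ?_)
      · exact measure_mono_null Set.inter_subset_left hA.frontier
      · exact measure_mono_null Set.inter_subset_right hB.frontier

/-- A closed set may have a boundary of positive measure, but it is a countable intersection of
thickenings whose boundaries are null for the marginal at `g`. -/
theorem generateFrom_isTameSet {G X : Type*} [PseudoMetricSpace X]
    [MeasurableSpace X] [BorelSpace X] (μ : Measure (G → X)) [IsFiniteMeasure μ] :
    MeasurableSpace.pi = MeasurableSpace.generateFrom {A : Set (G → X) | IsTameSet μ A} := by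
  refine le_antisymm (iSup_le fun g => ?_)
    (MeasurableSpace.generateFrom_le fun A hA => hA.measurableSet)
  have hX : ‹MeasurableSpace X› = MeasurableSpace.generateFrom {F | IsClosed F} :=
    BorelSpace.measurable_eq.trans borel_eq_generateFrom_isClosed
  refine ((congrArg (MeasurableSpace.comap fun x : G → X => x g) hX).trans
    MeasurableSpace.comap_generateFrom).le.trans (MeasurableSpace.generateFrom_le ?_)
  rintro _ ⟨F, hF, rfl⟩
  obtain ⟨r, hr0, hr⟩ := exists_null_frontiers_thickening (μ.map fun x => x g) F
  have hF' : F = ⋂ n, Metric.thickening (r n) F := by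
    refine Set.Subset.antisymm
      (Set.subset_iInter fun n => Metric.self_subset_thickening (hr n).1 F) fun x hx => ?_
    rcases F.eq_empty_or_nonempty with rfl | hne
    · simp at hx
    rw [← hF.closure_eq, Metric.mem_closure_iff_infDist_zero hne]
    refine le_antisymm (ge_of_tendsto' hr0 fun n => ?_) Metric.infDist_nonneg
    obtain ⟨y, hy, hxy⟩ := Metric.mem_thickening_iff.1 (Set.mem_iInter.1 hx n)
    exact (Metric.infDist_le_dist_of_mem hy).trans hxy.le
  rw [hF', Set.preimage_iInter]
  refine MeasurableSet.iInter fun n => MeasurableSpace.measurableSet_generateFrom ?_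
  refine ⟨measurable_pi_apply g Metric.isOpen_thickening.measurableSet,
    ⟨{g}, fun x y h => ?_⟩, ?_⟩
  · simp only [Set.mem_preimage, h g (by simp)]
  · refine measure_mono_null ((continuous_apply g).frontier_preimage_subset _) ?_
    have := (hr n).2
    rwa [Measure.map_apply (measurable_pi_apply g) isClosed_frontier.measurableSet] at this

theorem IsTame.const {Y : Type*} [TopologicalSpace Y] [MeasurableSpace Y] (c : Y) :
    IsTame μ fun _ => c :=
  ⟨measurable_const, ⟨∅, fun _ _ _ => rfl⟩, .of_forall fun _ => continuousAt_const⟩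

theorem IsTame.piecewise {Y : Type*} [TopologicalSpace Y] [MeasurableSpace Y]
    {f g : (G → X) → Y} {A : Set (G → X)} [DecidablePred (· ∈ A)] (hf : IsTame μ f)
    (hg : IsTame μ g) (hA : IsTameSet μ A) : IsTame μ (A.piecewise f g) := by
  classical
  obtain ⟨D, hD⟩ := hA.dependsOn
  obtain ⟨E, hE⟩ := hf.dependsOn
  obtain ⟨F, hF⟩ := hg.dependsOn
  refine ⟨hf.measurable.piecewise hA.measurableSet hg.measurable, ⟨D ∪ E ∪ F, ?_⟩, ?_⟩
  · intro x y h
    have h1 : (x ∈ A) = (y ∈ A) := hD fun i hi => h i (by simp_all)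
    have h2 : f x = f y := hE fun i hi => h i (by simp_all)
    have h3 : g x = g y := hF fun i hi => h i (by simp_all)
    simp only [Set.piecewise, h1, h2, h3]
  · have hfr : ∀ᵐ x ∂μ, x ∉ frontier A := measure_eq_zero_iff_ae_notMem.1 hA.frontier
    filter_upwards [hf.continuousAt, hg.continuousAt, hfr] with x hxf hxg hx
    by_cases hxA : x ∈ interior A
    · refine hxf.congr ?_
      filter_upwards [isOpen_interior.mem_nhds hxA] with y hy
      exact (Set.piecewise_eq_of_mem _ _ _ (interior_subset hy)).symm
    · have hxc : x ∈ (closure A)ᶜ := fun hc => hx ⟨hc, hxA⟩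
      refine hxg.congr ?_
      filter_upwards [isClosed_closure.isOpen_compl.mem_nhds hxc] with y hy
      exact (Set.piecewise_eq_of_notMem _ _ _ fun h => hy (subset_closure h)).symm

theorem SimpleFunc.exists_isTame {G X Y : Type*} [PseudoMetricSpace X]
    [MeasurableSpace X] [BorelSpace X] [TopologicalSpace Y] [MeasurableSpace Y] [Nonempty Y]
    (μ : Measure (G → X)) [IsFiniteMeasure μ] (s : SimpleFunc (G → X) Y) :
    ∀ ε : ℝ, 0 < ε → ∃ f, IsTame μ f ∧ μ {x | f x ≠ s x} ≤ ENNReal.ofReal ε := by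
  classical
  induction s using SimpleFunc.induction' with
  | const c => exact fun ε _ => ⟨_, IsTame.const c, by simp⟩
  | @pcw s t A hA hs ht =>
    intro ε hε
    obtain ⟨f, hf, hfs⟩ := hs (ε / 3) (by positivity)
    obtain ⟨g, hg, hgt⟩ := ht (ε / 3) (by positivity)
    -- A set algebra generating the σ-algebra is dense in measure, so `A` may be replaced by a tame
    -- set.
    obtain ⟨B, hB, hAB⟩ := (Measure.MeasureDense.of_generateFrom_isSetAlgebra_finite
      (μ := μ) isSetAlgebra_isTameSet (generateFrom_isTameSet μ)).approx A hA (measure_ne_top _ _)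
      (ε / 3) (by positivity)
    refine ⟨B.piecewise f g, hf.piecewise hg hB, ?_⟩
    have hsub : {x | B.piecewise f g x ≠ s.piecewise A hA t x} ⊆
        {x | f x ≠ s x} ∪ {x | g x ≠ t x} ∪ symmDiff A B := by
      intro x hx
      by_contra hcon
      simp only [Set.mem_union, Set.mem_ofPred_eq, not_or, not_not, Set.mem_symmDiff] at hcon
      refine hx ?_
      by_cases hxA : x ∈ A <;> by_cases hxB : x ∈ B <;> simp_all [Set.piecewise]
    calc μ _ ≤ μ {x | f x ≠ s x} + μ {x | g x ≠ t x} + μ (symmDiff A B) :=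
          (measure_mono hsub).trans ((measure_union_le _ _).trans
            (add_le_add_left (measure_union_le _ _) _))
      _ ≤ ENNReal.ofReal (ε / 3) + ENNReal.ofReal (ε / 3) + ENNReal.ofReal (ε / 3) :=
          add_le_add (add_le_add hfs hgt) hAB.le
      _ = ENNReal.ofReal ε := by
          rw [← ENNReal.ofReal_add (by positivity) (by positivity),
            ← ENNReal.ofReal_add (by positivity) (by positivity)]
          congr 1; ring

/-- Every measurable map from `X^G` to a second countable metric space is an almost everywhere
limit of tame maps. -/
theorem exists_seq_isTame_tendsto_ae {G X Y : Type*} [PseudoMetricSpace X]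
    [MeasurableSpace X] [BorelSpace X] [PseudoMetricSpace Y] [SecondCountableTopology Y]
    [MeasurableSpace Y] [BorelSpace Y] [Nonempty Y] (μ : Measure (G → X)) [IsFiniteMeasure μ]
    {φ : (G → X) → Y} (hφ : Measurable φ) :
    ∃ f : ℕ → (G → X) → Y, (∀ m, IsTame μ (f m)) ∧
      ∀ᵐ x ∂μ, Tendsto (fun m => f m x) atTop (𝓝 (φ x)) := by
  let s : ℕ → SimpleFunc (G → X) Y :=
    SimpleFunc.approxOn φ hφ Set.univ (Classical.arbitrary Y) (Set.mem_univ _)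
  choose f hf hfs using fun m : ℕ =>
    SimpleFunc.exists_isTame μ (s m) ((1 / 2 : ℝ) ^ m) (by positivity)
  refine ⟨f, hf, ?_⟩
  -- Borel–Cantelli: the errors `2⁻ᵐ` are summable, so almost surely `f m x = s m x` for all large
  -- `m`.
  have hsum : ∑' m, μ {x | f m x ≠ s m x} ≠ ∞ := by
    refine ne_top_of_le_ne_top ?_ (ENNReal.tsum_le_tsum hfs)
    rw [← ENNReal.ofReal_tsum_of_nonneg (fun _ => by positivity) summable_geometric_two]
    exact ENNReal.ofReal_ne_top
  filter_upwards [ae_eventually_notMem hsum] with x hx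
  have hlim : Tendsto (fun m => s m x) atTop (𝓝 (φ x)) :=
    SimpleFunc.tendsto_approxOn hφ (Set.mem_univ _) (by simp)
  refine hlim.congr' ?_
  filter_upwards [hx] with m hm
  simpa using (not_not.1 hm).symm

end Tame

/-! ### Filters of high-probability events -/

section ModelFilters

/-- The filter of events whose probability tends to `1` along a sequence of (outer) measures. -/
def highProbabilityFilter {Ω : ℕ → Type*} (m : ∀ n, OuterMeasure (Ω n)) : Filter (Σ n, Ω n) where
  -- Outer measures spare any measurability of events; stability under intersection then comes from
  -- subadditivity applied to the complements.
  sets := {A | Tendsto (fun n => m n {ω | (⟨n, ω⟩ : Σ n, Ω n) ∉ A}) atTop (𝓝 0)}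
  univ_sets := by simp
  sets_of_superset {A B} hA hAB := by
    refine tendsto_of_tendsto_of_tendsto_of_le_of_le tendsto_const_nhds hA
      (fun _ => zero_le) fun n => measure_mono fun ω hω h => hω (hAB h)
  inter_sets {A B} hA hB := by
    refine tendsto_of_tendsto_of_tendsto_of_le_of_le tendsto_const_nhds
      (by simpa using Tendsto.add hA hB) (fun _ => zero_le) fun n => ?_
    refine (measure_mono fun ω hω => ?_).trans (measure_union_le _ _)
    by_contra h
    simp only [Set.mem_union, Set.mem_ofPred_eq, not_or, not_not] at h
    exact hω h

theorem eventually_highProbabilityFilter {Ω : ℕ → Type*} {m : ∀ n, OuterMeasure (Ω n)}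
    {P : (Σ n, Ω n) → Prop} :
    (∀ᶠ p in highProbabilityFilter m, P p) ↔
      Tendsto (fun n => m n {ω | ¬ P ⟨n, ω⟩}) atTop (𝓝 0) := Iff.rfl

theorem tendsto_fst_highProbabilityFilter {Ω : ℕ → Type*} (m : ∀ n, OuterMeasure (Ω n)) :
    Tendsto Sigma.fst (highProbabilityFilter m) atTop := by
  intro A hA
  refine tendsto_const_nhds.congr' ?_
  filter_upwards [hA] with n hn
  simp [hn]

/-- The normalized counting measure on the subsets of a finite set. -/
noncomputable def uniformOuterMeasure (V : Type*) [Fintype V] : OuterMeasure V :=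
  letI : MeasurableSpace V := ⊤
  ((Fintype.card V : ℝ≥0∞)⁻¹ • Measure.count : Measure V).toOuterMeasure

theorem uniformOuterMeasure_apply {V : Type*} [Fintype V] (A : Set V) :
    uniformOuterMeasure V A = (Fintype.card V : ℝ≥0∞)⁻¹ * (A.ncard : ℝ≥0∞) := by
  let _ : MeasurableSpace V := ⊤
  have h : Measure.count A = (A.ncard : ℝ≥0∞) := by
    rw [Measure.count_apply MeasurableSpace.measurableSet_top, ← Set.Finite.cast_ncard_eq A.toFinite]
    rfl
  rw [← h]
  exact Measure.smul_apply _ Measure.count A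

theorem toReal_uniformOuterMeasure {V : Type*} [Fintype V] (A : Set V) :
    (uniformOuterMeasure V A).toReal = (A.ncard : ℝ) / Fintype.card V := by
  rw [uniformOuterMeasure_apply, ENNReal.toReal_mul, ENNReal.toReal_inv]
  simp [div_eq_mul_inv, mul_comm]

theorem uniformOuterMeasure_ne_top {V : Type*} [Fintype V] [Nonempty V] (A : Set V) :
    uniformOuterMeasure V A ≠ ∞ := by
  rw [uniformOuterMeasure_apply]
  exact ENNReal.mul_ne_top (by simp) (by simp)

theorem ncard_compl_div_card {V : Type*} [Fintype V] [Nonempty V] (P : V → Prop) :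
    ({v | ¬ P v}.ncard : ℝ) / Fintype.card V = 1 - ({v | P v}.ncard : ℝ) / Fintype.card V := by
  have h := Set.ncard_add_ncard_compl {v | P v}
  rw [Nat.card_eq_fintype_card] at h
  have h' : ({v | P v}.ncard : ℝ) + ({v | ¬ P v}.ncard : ℝ) = Fintype.card V := by
    exact_mod_cast h
  have : (Fintype.card V : ℝ) ≠ 0 := by simp
  field_simp
  linarith

variable {V : ℕ → Type*} [∀ n, Fintype (V n)] [∀ n, Nonempty (V n)]

/-- The filter of properties which hold with high probability at a uniformly random vertex. -/
noncomputable abbrev vertexFilter (V : ℕ → Type*) [∀ n, Fintype (V n)] : Filter (Σ n, V n) :=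
  highProbabilityFilter fun n => uniformOuterMeasure (V n)

theorem eventually_vertexFilter_iff {P : (Σ n, V n) → Prop} :
    (∀ᶠ p in vertexFilter V, P p) ↔
      Tendsto (fun n => ({v : V n | ¬ P ⟨n, v⟩}.ncard : ℝ) / Fintype.card (V n))
        atTop (𝓝 0) := by
  rw [eventually_highProbabilityFilter, ← ENNReal.tendsto_toReal_iff
    (fun n => uniformOuterMeasure_ne_top _) (by simp)]
  simp only [toReal_uniformOuterMeasure, ENNReal.toReal_zero]

theorem withHighProbability_iff {P : ∀ n, V n → Prop} :
    WithHighProbability P ↔ ∀ᶠ p in vertexFilter V, P p.1 p.2 := by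
  rw [eventually_vertexFilter_iff, WithHighProbability]
  simp only [ncard_compl_div_card]
  constructor
  · intro h; simpa using h.const_sub 1
  · intro h; simpa using h.const_sub 1

end ModelFilters

/-! ### Integrals and continuity of empirical distributions -/

section Empirical

variable {G V X : Type*} [Fintype V] [Nonempty V] [MeasurableSpace X]

theorem integral_empiricalDistribution (σ : G → Equiv.Perm V) (x : V → X) {f : (G → X) → ℝ}
    (hf : StronglyMeasurable f) :
    ∫ z, f z ∂(empiricalDistribution σ x : Measure (G → X)) =
      (∑ v, f (pullbackName σ v x)) / Fintype.card V := by
  have : (empiricalDistribution σ x : Measure (G → X)) =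
    (Fintype.card V : ℝ≥0∞)⁻¹ • ∑ v : V, Measure.dirac (pullbackName σ v x) := rfl
  rw [this, integral_smul_measure, integral_finsetSum_measure]
  · simp [integral_dirac' _ _ hf, div_eq_inv_mul]
  · intro v _
    refine ⟨hf.aestronglyMeasurable, ?_⟩
    rw [HasFiniteIntegral, lintegral_dirac' _ hf.measurable.enorm]
    simp

theorem continuous_pullbackName {G V X : Type*} [TopologicalSpace X] (σ : G → Equiv.Perm V) (v : V) :
    Continuous (pullbackName (X := X) σ v) :=
  continuous_pi fun g => continuous_apply (σ g v)

theorem continuous_empiricalDistribution [Countable G] [TopologicalSpace X]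
    [SecondCountableTopology X] [BorelSpace X]
    [TopologicalSpace.PseudoMetrizableSpace X] (σ : G → Equiv.Perm V) :
    Continuous (empiricalDistribution (X := X) σ) := by
  rw [continuous_iff_continuousAt]
  intro x
  refine ProbabilityMeasure.tendsto_iff_forall_integral_tendsto.2 fun f => ?_
  simp only [integral_empiricalDistribution σ _ f.continuous.stronglyMeasurable]
  refine Continuous.tendsto (f := fun y => (∑ v, f (pullbackName σ v y)) / (Fintype.card V : ℝ))
    ?_ x
  exact (continuous_finsetSum _ fun v _ =>
    f.continuous.comp (continuous_pullbackName σ v)).div_const _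

end Empirical

/-! ### Quenched convergence as convergence along filters -/

section Quenched

variable {G X Z : Type*} [Group G] [Countable G]
  [MeasurableSpace X]
  [TopologicalSpace Z] [SecondCountableTopology Z] [MeasurableSpace Z] [BorelSpace Z]
  {S : SoficApproximation G}

theorem localWeakStarConverges_iff_tendsto [TopologicalSpace X] [SecondCountableTopology X]
    [BorelSpace X] {μs : ∀ n, ProbabilityMeasure (S.V n → X)}
    {μ : ProbabilityMeasure (G → X)} :
    LocalWeakStarConverges S μs μ ↔
      Tendsto (fun p : Σ n, S.V n => localMarginal (S.σ p.1) (μs p.1) p.2)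
        (vertexFilter S.V) (𝓝 μ) := by
  simp only [LocalWeakStarConverges, withHighProbability_iff]
  rfl

theorem tendsto_measure_compl_zero_iff {Ω : ℕ → Type*} [∀ n, MeasurableSpace (Ω n)]
    {m : ∀ n, Measure (Ω n)} [∀ n, IsProbabilityMeasure (m n)] {A : ∀ n, Set (Ω n)}
    (hA : ∀ n, MeasurableSet (A n)) :
    Tendsto (fun n => m n (A n)ᶜ) atTop (𝓝 0) ↔ Tendsto (fun n => m n (A n)) atTop (𝓝 1) := by
  have h1 : ∀ n, m n (A n)ᶜ = 1 - m n (A n) := fun n => prob_compl_eq_one_sub (hA n)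
  have h2 : ∀ n, m n (A n) = 1 - m n (A n)ᶜ := fun n => by
    rw [← prob_compl_eq_one_sub (hA n).compl, compl_compl]
  constructor
  · intro h
    simp only [h2]
    simpa using ENNReal.Tendsto.sub (tendsto_const_nhds (x := (1 : ℝ≥0∞))) h (.inl (by simp))
  · intro h
    simp only [h1]
    simpa using ENNReal.Tendsto.sub (tendsto_const_nhds (x := (1 : ℝ≥0∞))) h (.inl (by simp))

/-- Quenched convergence of a sequence of image measures, as convergence along filters. -/
theorem quenchedConverges_map_iff [TopologicalSpace.PseudoMetrizableSpace Z]
    {μs : ∀ n, ProbabilityMeasure (S.V n → X)}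
    {q : ∀ n, (S.V n → X) → (S.V n → Z)} (hq : ∀ n, Measurable (q n))
    {μ : ProbabilityMeasure (G → Z)} :
    QuenchedConverges S (fun n => (μs n).map (hq n).aemeasurable) μ ↔
      Tendsto (fun p : Σ n, S.V n => (μs p.1).map
          ((measurable_pullbackName (S.σ p.1) p.2).comp (hq p.1)).aemeasurable)
        (vertexFilter S.V) (𝓝 μ) ∧
      Tendsto (fun p : Σ n, S.V n → X => empiricalDistribution (S.σ p.1) (q p.1 p.2))
        (highProbabilityFilter fun n => (μs n : Measure (S.V n → X)).toOuterMeasure) (𝓝 μ) := by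
  have hloc : ∀ p : Σ n, S.V n,
      localMarginal (S.σ p.1) ((μs p.1).map (hq p.1).aemeasurable) p.2 =
      (μs p.1).map ((measurable_pullbackName (S.σ p.1) p.2).comp (hq p.1)).aemeasurable :=
    fun p => Subtype.ext (Measure.map_map (measurable_pullbackName _ _) (hq _))
  have hmeas : ∀ (U : Set (ProbabilityMeasure (G → Z))) (_ : IsOpen U) (n : ℕ),
      MeasurableSet (goodModels U (S.σ n)) := fun U hU n =>
    (hU.preimage (continuous_empiricalDistribution (S.σ n))).measurableSet
  -- Good models of an open set are measurable, so complements can be taken; a general neighbourhood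
  -- is then reached by monotonicity.
  have hopen : ∀ (U : Set (ProbabilityMeasure (G → Z))) (_ : IsOpen U),
      Tendsto (fun n => ((μs n).map (hq n).aemeasurable : Measure (S.V n → Z))
        (goodModels U (S.σ n))) atTop (𝓝 1) ↔
      ∀ᶠ p in highProbabilityFilter fun n => (μs n : Measure (S.V n → X)).toOuterMeasure,
        empiricalDistribution (S.σ p.1) (q p.1 p.2) ∈ U := by
    intro U hU
    rw [eventually_highProbabilityFilter, ← tendsto_measure_compl_zero_iff (hmeas U hU)]
    refine tendsto_congr fun n => ?_
    rw [ProbabilityMeasure.map_apply' _ _ (hmeas U hU n).compl]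
    rfl
  rw [QuenchedConverges, localWeakStarConverges_iff_tendsto]
  simp only [hloc]
  refine and_congr_right fun _ => ⟨fun h => ?_, fun h O hO => ?_⟩
  · rw [tendsto_nhds]
    exact fun U hU hμ => (hopen U hU).1 (h U (hU.mem_nhds hμ))
  · obtain ⟨U, hUO, hU, hμ⟩ := mem_nhds_iff.1 hO
    refine tendsto_of_tendsto_of_tendsto_of_le_of_le
      ((hopen U hU).2 (h.eventually (hU.mem_nhds hμ))) tendsto_const_nhds
      (fun n => measure_mono fun z hz => hUO hz) fun n => prob_le_one

theorem quenchedConverges_iff [TopologicalSpace X] [SecondCountableTopology X]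
    [BorelSpace X] [TopologicalSpace.PseudoMetrizableSpace X]
    {μs : ∀ n, ProbabilityMeasure (S.V n → X)} {μ : ProbabilityMeasure (G → X)} :
    QuenchedConverges S μs μ ↔
      Tendsto (fun p : Σ n, S.V n => localMarginal (S.σ p.1) (μs p.1) p.2)
        (vertexFilter S.V) (𝓝 μ) ∧
      Tendsto (fun p : Σ n, S.V n → X => empiricalDistribution (S.σ p.1) p.2)
        (highProbabilityFilter fun n => (μs n : Measure (S.V n → X)).toOuterMeasure) (𝓝 μ) := by
  have h := quenchedConverges_map_iff (S := S) (μs := μs) (μ := μ)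
    (q := fun n => id) (fun n => measurable_id)
  have hid : ∀ n, (μs n).map (measurable_id (α := S.V n → X)).aemeasurable = μs n :=
    fun n => Subtype.ext Measure.map_id
  simp only [hid] at h
  exact h

end Quenched

/-! ### Block maps on `X^G` and their finite counterparts -/

section BlockMaps

variable {G V X Z : Type*} [Group G]

/-- The shift-equivariant map `X^G → Z^G` with coordinate map `τ` at the identity. -/
def blockMap (τ : (G → X) → Z) (x : G → X) : G → Z :=
  fun g => τ (rightShift g x)

/-- The map `X^V → Z^V` obtained by applying `τ` to all pullback names. -/
def modelMap (σ : G → Equiv.Perm V) (τ : (G → X) → Z) (x : V → X) : V → Z :=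
  fun v => τ (pullbackName σ v x)

theorem measurable_rightShift [MeasurableSpace X] (g : G) :
    Measurable (rightShift (X := X) g) :=
  measurable_pi_lambda _ fun h => measurable_pi_apply (h * g)

theorem continuous_rightShift [TopologicalSpace X] (g : G) :
    Continuous (rightShift (X := X) g) :=
  continuous_pi fun h => continuous_apply (h * g)

theorem measurable_blockMap [MeasurableSpace X] [MeasurableSpace Z] {τ : (G → X) → Z}
    (hτ : Measurable τ) : Measurable (blockMap τ) :=
  measurable_pi_lambda _ fun g => hτ.comp (measurable_rightShift g)

omit [Group G] in
theorem measurable_modelMap [MeasurableSpace X] [MeasurableSpace Z] (σ : G → Equiv.Perm V)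
    {τ : (G → X) → Z} (hτ : Measurable τ) : Measurable (modelMap σ τ) :=
  measurable_pi_lambda _ fun v => hτ.comp (measurable_pullbackName σ v)

theorem IsGProcess.ae_forall_rightShift [Countable G] [MeasurableSpace X]
    {μ : ProbabilityMeasure (G → X)} (hμ : IsGProcess μ) {P : (G → X) → Prop}
    (h : ∀ᵐ x ∂(μ : Measure (G → X)), P x) :
    ∀ᵐ x ∂(μ : Measure (G → X)), ∀ g, P (rightShift g x) :=
  ae_all_iff.2 fun g => (hμ g).quasiMeasurePreserving.ae h

theorem ae_continuousAt_blockMap [Countable G] [TopologicalSpace X] [MeasurableSpace X]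
    [TopologicalSpace Z] {μ : ProbabilityMeasure (G → X)} (hμ : IsGProcess μ)
    {τ : (G → X) → Z} (hτ : ∀ᵐ x ∂(μ : Measure (G → X)), ContinuousAt τ x) :
    ∀ᵐ x ∂(μ : Measure (G → X)), ContinuousAt (blockMap τ) x := by
  filter_upwards [hμ.ae_forall_rightShift hτ] with x hx
  exact continuousAt_pi.2 fun g => (hx g).comp (continuous_rightShift g).continuousAt

theorem exists_finset_of_mem_uniformity_pi {ι Z : Type*} [PseudoMetricSpace Z]
    {U : Set ((ι → Z) × (ι → Z))} (hU : U ∈ uniformity (ι → Z)) :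
    ∃ E : Finset ι, ∃ r > 0, ∀ z z', (∀ i ∈ E, dist (z i) (z' i) < r) → (z, z') ∈ U := by
  rw [Pi.uniformity, mem_iInf] at hU
  obtain ⟨I, hI, U, hU, rfl⟩ := hU
  have h : ∀ i : I, ∃ r > 0, ∀ z z' : ι → Z, dist (z i) (z' i) < r → (z, z') ∈ U i := by
    intro i
    obtain ⟨W, hW, hWU⟩ := mem_comap.1 (hU i)
    obtain ⟨r, hr, hrW⟩ := Metric.mem_uniformity_dist.1 hW
    exact ⟨r, hr, fun z z' h => hWU (hrW h)⟩
  choose r hr hrU using h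
  have : Finite I := hI
  obtain ⟨ρ, hρ, hρr⟩ : ∃ ρ > 0, ∀ i, ρ ≤ r i := by
    rcases isEmpty_or_nonempty I with hI | hI
    · exact ⟨1, one_pos, fun i => hI.elim i⟩
    · obtain ⟨i, hi⟩ := Finite.exists_min r
      exact ⟨r i, hr i, hi⟩
  refine ⟨hI.toFinset, ρ, hρ, fun z z' h => Set.mem_iInter.2 fun i => hrU i z z' ?_⟩
  exact (h i (hI.mem_toFinset.2 i.2)).trans_le (hρr i)

theorem exists_finset_dist_lt {ι Z : Type*} [PseudoMetricSpace Z] [CompactSpace Z]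
    (f : C(ι → Z, ℝ)) {ε : ℝ} (hε : 0 < ε) :
    ∃ E : Finset ι, ∀ z z', (∀ i ∈ E, z i = z' i) → dist (f z) (f z') < ε := by
  have hf := CompactSpace.uniformContinuous_of_continuous f.continuous
  obtain ⟨E, r, hr, hE⟩ := exists_finset_of_mem_uniformity_pi (hf (Metric.dist_mem_uniformity hε))
  exact ⟨E, fun z z' h => hE z z' fun i hi => by rwa [h i hi, dist_self]⟩

/-- The two sides apply `τ` to names reading `x` at `σ h (σ g v)` and at `σ (h * g) v`. As `σ` is
only asymptotically multiplicative, these agree just at good vertices. -/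
theorem pullbackName_modelMap_eq {σ : G → Equiv.Perm V} {τ : (G → X) → Z} {D : Set G}
    (hτ : DependsOn τ D) {v : V} {g : G} (hv : ∀ h ∈ D, σ h (σ g v) = σ (h * g) v) (x : V → X) :
    pullbackName σ v (modelMap σ τ x) g = blockMap τ (pullbackName σ v x) g :=
  hτ fun h hh => congrArg x (hv h hh)

theorem SoficApproximation.eventually_mul (S : SoficApproximation G) (E D : Finset G) :
    ∀ᶠ p in vertexFilter S.V, ∀ g ∈ E, ∀ h ∈ D,
      S.σ p.1 h (S.σ p.1 g p.2) = S.σ p.1 (h * g) p.2 := by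
  refine (eventually_all_finset E).2 fun g _ => (eventually_all_finset D).2 fun h _ => ?_
  exact (withHighProbability_iff (V := S.V)
    (P := fun n v => S.σ n h (S.σ n g v) = S.σ n (h * g) v)).1 (S.mul_whp h g)

end BlockMaps

/-! ### Transfer of quenched convergence along tame maps and their limits -/

section Transfer

variable {G X Z : Type*} [Group G] [Countable G]
  [TopologicalSpace X] [TopologicalSpace.PseudoMetrizableSpace X] [SecondCountableTopology X]
  [MeasurableSpace X] [BorelSpace X]
  [MetricSpace Z] [CompactSpace Z] [MeasurableSpace Z] [BorelSpace Z]
  {S : SoficApproximation G}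

theorem abs_average_sub_le {V : Type*} [Fintype V] [Nonempty V] {a b : V → ℝ} {ε M : ℝ}
    (hε : 0 ≤ ε) (hM : ∀ v, |a v - b v| ≤ M) :
    |(∑ v, a v) / Fintype.card V - (∑ v, b v) / Fintype.card V| ≤
      ε + M * (({v | ¬ |a v - b v| ≤ ε}.ncard : ℝ) / Fintype.card V) := by
  classical
  have hc : (0 : ℝ) < Fintype.card V := by simp [Fintype.card_pos]
  have hM0 : 0 ≤ M := (abs_nonneg _).trans (hM (Classical.arbitrary V))
  rw [← sub_div, ← Finset.sum_sub_distrib, abs_div, abs_of_pos hc, div_le_iff₀ hc]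
  have h1 : ∀ v, |a v - b v| ≤ ε + if ¬ |a v - b v| ≤ ε then M else 0 := by
    intro v
    split_ifs with h
    · linarith
    · linarith [hM v]
  calc |∑ v, (a v - b v)| ≤ ∑ v, |a v - b v| := Finset.abs_sum_le_sum_abs _ _
    _ ≤ ∑ v, (ε + if ¬ |a v - b v| ≤ ε then M else 0) := Finset.sum_le_sum fun v _ => h1 v
    _ = (ε + M * (({v | ¬ |a v - b v| ≤ ε}.ncard : ℝ) / Fintype.card V)) * Fintype.card V := by
      rw [Finset.sum_add_distrib, ← Finset.sum_filter, Finset.sum_const, Finset.sum_const,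
        Set.ncard_eq_toFinset_card', Set.toFinset_ofPred]
      simp only [Finset.card_univ, nsmul_eq_mul]
      field_simp

/-- Images of a quenched-convergent sequence under a tame map quenched-converge. -/
theorem QuenchedConverges.modelMap {μs : ∀ n, ProbabilityMeasure (S.V n → X)}
    {μ : ProbabilityMeasure (G → X)} (hμ : IsGProcess μ) (h : QuenchedConverges S μs μ)
    {τ : (G → X) → Z} (hτ : IsTame (μ : Measure (G → X)) τ) :
    QuenchedConverges S
      (fun n => (μs n).map (measurable_modelMap (S.σ n) hτ.measurable).aemeasurable)
      (μ.map (measurable_blockMap hτ.measurable).aemeasurable) := by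
  obtain ⟨D, hD⟩ := hτ.dependsOn
  have hcont := ProbabilityMeasure.continuousAt_map_of_ae_continuousAt
    (measurable_blockMap hτ.measurable) (ae_continuousAt_blockMap hμ hτ.continuousAt)
  rw [quenchedConverges_iff] at h
  rw [quenchedConverges_map_iff (fun n => measurable_modelMap (S.σ n) hτ.measurable)]
  -- A continuous test function on a compact product sees finitely many coordinates up to `ε`. At a
  -- vertex multiplicative on this window the bound holds for all `x` at once.
  have hgood : ∀ (f : BoundedContinuousFunction (G → Z) ℝ) (ε : ℝ), 0 < ε →
      ∀ᶠ p in vertexFilter S.V, ∀ x : S.V p.1 → X,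
        |f (blockMap τ (pullbackName (S.σ p.1) p.2 x)) -
          f (pullbackName (S.σ p.1) p.2 (_root_.modelMap (S.σ p.1) τ x))| ≤ ε := by
    intro f ε hε
    obtain ⟨E, hE⟩ := exists_finset_dist_lt f.toContinuousMap hε
    filter_upwards [S.eventually_mul E D] with p hp x
    exact (hE _ _ fun g hg => (pullbackName_modelMap_eq hD (hp g hg) x).symm).le
  constructor
  · refine ProbabilityMeasure.tendsto_iff_forall_integral_tendsto.2 fun f => ?_
    refine (ProbabilityMeasure.tendsto_iff_forall_integral_tendsto.1
      (hcont.tendsto.comp h.1) f).congr_dist ?_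
    refine Metric.tendsto_nhds.2 fun ε hε => ?_
    filter_upwards [hgood f (ε / 2) (half_pos hε)] with p hp
    rw [Real.dist_0_eq_abs, abs_of_nonneg dist_nonneg]
    have hm1 := (measurable_blockMap hτ.measurable).comp
      (measurable_pullbackName (X := X) (S.σ p.1) p.2)
    have hm2 := (measurable_pullbackName (X := Z) (S.σ p.1) p.2).comp
      (measurable_modelMap (S.σ p.1) hτ.measurable)
    have e1 : ∫ z, f z ∂(((localMarginal (S.σ p.1) (μs p.1) p.2).map
        (measurable_blockMap hτ.measurable).aemeasurable : ProbabilityMeasure (G → Z)) :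
          Measure (G → Z)) =
        ∫ x, f (blockMap τ (pullbackName (S.σ p.1) p.2 x)) ∂(μs p.1 : Measure (S.V p.1 → X)) := by
      rw [localMarginal, ProbabilityMeasure.toMeasure_map, ProbabilityMeasure.toMeasure_map,
        Measure.map_map (measurable_blockMap hτ.measurable) (measurable_pullbackName _ _),
        integral_map hm1.aemeasurable f.continuous.aestronglyMeasurable]
      rfl
    have e2 : ∫ z, f z ∂(((μs p.1).map hm2.aemeasurable : ProbabilityMeasure (G → Z)) :
          Measure (G → Z)) =
        ∫ x, f (pullbackName (S.σ p.1) p.2 (_root_.modelMap (S.σ p.1) τ x))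
          ∂(μs p.1 : Measure (S.V p.1 → X)) := by
      rw [ProbabilityMeasure.toMeasure_map,
        integral_map hm2.aemeasurable f.continuous.aestronglyMeasurable]
      rfl
    have i1 : Integrable (fun x => f (blockMap τ (pullbackName (S.σ p.1) p.2 x)))
        (μs p.1 : Measure (S.V p.1 → X)) :=
      .of_bound (f.continuous.measurable.comp hm1).aestronglyMeasurable ‖f‖
        (.of_forall fun x => f.norm_coe_le_norm _)
    have i2 : Integrable (fun x => f (pullbackName (S.σ p.1) p.2
        (_root_.modelMap (S.σ p.1) τ x))) (μs p.1 : Measure (S.V p.1 → X)) :=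
      .of_bound (f.continuous.measurable.comp hm2).aestronglyMeasurable ‖f‖
        (.of_forall fun x => f.norm_coe_le_norm _)
    refine lt_of_le_of_lt ?_ (half_lt_self hε)
    refine (congrArg₂ dist e1 e2).trans_le ?_
    rw [Real.dist_eq, ← integral_sub i1 i2]
    have := norm_integral_le_of_norm_le_const (μ := (μs p.1 : Measure (S.V p.1 → X)))
      (f := fun x => f (blockMap τ (pullbackName (S.σ p.1) p.2 x)) -
        f (pullbackName (S.σ p.1) p.2 (_root_.modelMap (S.σ p.1) τ x)))
      (C := ε / 2) (.of_forall hp)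
    simpa using this
  · refine ProbabilityMeasure.tendsto_iff_forall_integral_tendsto.2 fun f => ?_
    refine (ProbabilityMeasure.tendsto_iff_forall_integral_tendsto.1
      (hcont.tendsto.comp h.2) f).congr_dist ?_
    refine Metric.tendsto_nhds.2 fun ε hε => ?_
    -- The proportion of bad vertices is bounded independently of `x`, so this is a condition on `n`
    -- alone; each bad vertex costs at most `2 * ‖f‖`.
    have hbad := ((eventually_vertexFilter_iff.1 (hgood f (ε / 3) (by positivity))).const_mul
      (2 * ‖f‖)).eventually_lt_const (u := ε / 3) (by simpa using by positivity)
    filter_upwards [(tendsto_fst_highProbabilityFilter _).eventually hbad] with p hp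
    rw [Real.dist_0_eq_abs, abs_of_nonneg dist_nonneg]
    have e1 : ∫ z, f z ∂(((empiricalDistribution (S.σ p.1) p.2).map
        (measurable_blockMap hτ.measurable).aemeasurable : ProbabilityMeasure (G → Z)) :
          Measure (G → Z)) =
        (∑ v, f (blockMap τ (pullbackName (S.σ p.1) v p.2))) / Fintype.card (S.V p.1) := by
      rw [ProbabilityMeasure.toMeasure_map, integral_map
        (measurable_blockMap hτ.measurable).aemeasurable f.continuous.aestronglyMeasurable]
      exact integral_empiricalDistribution (S.σ p.1) p.2
        (f.continuous.measurable.comp (measurable_blockMap hτ.measurable)).stronglyMeasurable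
    have e2 := integral_empiricalDistribution (S.σ p.1) (_root_.modelMap (S.σ p.1) τ p.2)
      f.continuous.stronglyMeasurable
    refine (congrArg₂ dist e1 e2).trans_lt ?_
    rw [Real.dist_eq]
    refine (abs_average_sub_le (ε := ε / 3) (M := 2 * ‖f‖) (by positivity)
      fun v => ?_).trans_lt ?_
    · exact f.dist_le_two_norm _ _
    · refine lt_of_le_of_lt (add_le_add_right ?_ _)
        (show ε / 3 + ε / 3 < ε by linarith)
      refine le_trans ?_ hp.le
      refine mul_le_mul_of_nonneg_left ?_ (by positivity)
      refine div_le_div_of_nonneg_right ?_ (by positivity)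
      exact Nat.cast_le.2 (Set.ncard_le_ncard (fun v hv h => hv (h p.2)) (Set.toFinite _))

/-- `κ n` is the largest `j ≤ n` whose threshold `N j` has been passed; each fixed `j` is eventually
admissible. -/
theorem exists_tendsto_atTop_diagonal {P : ℕ → ℕ → Prop} (h : ∀ j, ∀ᶠ n in atTop, P j n) :
    ∃ κ : ℕ → ℕ, Tendsto κ atTop atTop ∧ ∀ᶠ n in atTop, P (κ n) n := by
  classical
  choose N hN using fun j => eventually_atTop.1 (h j)
  refine ⟨fun n => Nat.findGreatest (fun j => N j ≤ n) n, tendsto_atTop.2 fun b => ?_, ?_⟩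
  · filter_upwards [eventually_ge_atTop (max b (N b))] with n hn
    exact Nat.le_findGreatest (le_of_max_le_left hn) (le_of_max_le_right hn)
  -- `Nat.findGreatest` defaults to `0`, which is admissible only once `N 0 ≤ n`.
  · filter_upwards [eventually_ge_atTop (N 0)] with n hn
    exact hN _ _ (Nat.findGreatest_spec (P := fun j => N j ≤ n) (Nat.zero_le n) hn)

/-- For each set `O j` of a decreasing neighbourhood basis of `l'`, some `l m` has `O j` as a
neighbourhood. Hence `θ m n` meets both requirements for `O j` up to `1 / (j + 1)` once `n` is
large, and the index `j` may grow slowly with `n`. -/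
theorem exists_quenchedConverges_diagonal {θ : ∀ _ n, ProbabilityMeasure (S.V n → Z)}
    {l : ℕ → ProbabilityMeasure (G → Z)} {l' : ProbabilityMeasure (G → Z)}
    (hθ : ∀ m, QuenchedConverges S (θ m) (l m)) (hl : Tendsto l atTop (𝓝 l')) :
    ∃ k : ℕ → ℕ, QuenchedConverges S (fun n => θ (k n) n) l' := by
  obtain ⟨O, hO⟩ := (𝓝 l').exists_antitone_basis
  have hm : ∀ j, ∃ m, O j ∈ 𝓝 (l m) := fun j =>
    (hl.eventually (eventually_eventually_nhds.2 (hO.mem j))).exists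
  choose m hm using hm
  have hr : ∀ j : ℕ, (1 - 1 / ((j : ℝ) + 1)) < 1 := fun j => by
    have : (0 : ℝ) < 1 / ((j : ℝ) + 1) := by positivity
    linarith
  obtain ⟨κ, hκ, hκP⟩ := exists_tendsto_atTop_diagonal fun j =>
    ((hθ (m j)).1 _ (hm j)).eventually_const_lt (hr j) |>.and
    (((hθ (m j)).2 _ (hm j)).eventually_const_lt
      (u := ENNReal.ofReal (1 - 1 / ((j : ℝ) + 1))) (by simpa using hr j))
  have hlim : Tendsto (fun n => 1 - 1 / ((κ n : ℝ) + 1)) atTop (𝓝 1) := by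
    simpa using ((tendsto_one_div_add_atTop_nhds_zero_nat (𝕜 := ℝ)).comp hκ).const_sub 1
  refine ⟨fun n => m (κ n), fun U hU => ?_, fun U hU => ?_⟩
  · obtain ⟨j, -, hj⟩ := hO.1.mem_iff.1 hU
    refine tendsto_of_tendsto_of_tendsto_of_le_of_le' hlim tendsto_const_nhds ?_
      (.of_forall fun n => ?_)
    · filter_upwards [hκP, hκ.eventually_ge_atTop j] with n hn hjn
      refine hn.1.le.trans (div_le_div_of_nonneg_right ?_ (by positivity))
      exact Nat.cast_le.2 (Set.ncard_le_ncard (fun v hv => hj (hO.2 hjn hv)) (Set.toFinite _))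
    · rw [div_le_one (by simp [Fintype.card_pos])]
      exact_mod_cast (Set.ncard_le_card _).trans_eq Nat.card_eq_fintype_card
  · obtain ⟨j, -, hj⟩ := hO.1.mem_iff.1 hU
    refine tendsto_of_tendsto_of_tendsto_of_le_of_le'
      (ENNReal.ofReal_one ▸ ENNReal.tendsto_ofReal hlim) tendsto_const_nhds ?_
      (.of_forall fun n => prob_le_one)
    filter_upwards [hκP, hκ.eventually_ge_atTop j] with n hn hjn
    exact hn.2.le.trans (measure_mono (fun x hx => hj (hO.2 hjn hx) :
      goodModels (O (κ n)) (S.σ n) ⊆ goodModels U (S.σ n)))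

/-- If tame maps `τ m` converge to `τ'` almost everywhere, then along a suitable choice of
indices the images of a quenched-convergent sequence quenched-converge to the image under the
equivariant map induced by `τ'`. -/
theorem QuenchedConverges.exists_modelMap {μs : ∀ n, ProbabilityMeasure (S.V n → X)}
    {μ : ProbabilityMeasure (G → X)} (hμ : IsGProcess μ) (h : QuenchedConverges S μs μ)
    {τ : ℕ → (G → X) → Z} (hτ : ∀ m, IsTame (μ : Measure (G → X)) (τ m))
    {τ' : (G → X) → Z} (hτ' : Measurable τ')
    (hlim : ∀ᵐ x ∂(μ : Measure (G → X)), Tendsto (fun m => τ m x) atTop (𝓝 (τ' x))) :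
    ∃ k : ℕ → ℕ, QuenchedConverges S
      (fun n => (μs n).map (measurable_modelMap (S.σ n) (hτ (k n)).measurable).aemeasurable)
      (μ.map (measurable_blockMap hτ').aemeasurable) := by
  refine exists_quenchedConverges_diagonal
    (θ := fun m n => (μs n).map (measurable_modelMap (S.σ n) (hτ m).measurable).aemeasurable)
    (l := fun m => μ.map (measurable_blockMap (hτ m).measurable).aemeasurable)
    (fun m => h.modelMap hμ (hτ m)) ?_
  refine ProbabilityMeasure.tendsto_iff_forall_integral_tendsto.2 fun f => ?_
  have hint : ∀ {ρ : (G → X) → Z} (hρ : Measurable ρ),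
      ∫ z, f z ∂((μ.map (measurable_blockMap hρ).aemeasurable : ProbabilityMeasure (G → Z)) :
        Measure (G → Z)) =
      ∫ x, f (blockMap ρ x) ∂(μ : Measure (G → X)) := fun hρ =>
    integral_map (measurable_blockMap hρ).aemeasurable f.continuous.aestronglyMeasurable
  rw [hint hτ']
  simp_rw [fun m => hint (hτ m).measurable]
  refine tendsto_integral_of_dominated_convergence (fun _ => ‖f‖) (fun m => ?_)
    (integrable_const _) (fun m => .of_forall fun x => f.norm_coe_le_norm _) ?_
  · exact (f.continuous.measurable.comp
      (measurable_blockMap (hτ m).measurable)).aestronglyMeasurable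
  -- Invariance spreads convergence at the identity to all coordinates, for almost every `x`.
  · filter_upwards [hμ.ae_forall_rightShift hlim] with x hx
    exact (f.continuous.tendsto (blockMap τ' x)).comp
      (tendsto_pi_nhds.2 hx : Tendsto (fun m => blockMap (τ m) x) atTop (𝓝 (blockMap τ' x)))

end Transfer

/-! ### The Hamming average -/

section Hamming

variable {V X : Type*} [Fintype V] [MetricSpace X]

theorem hammingAverage_comm (x y : V → X) : hammingAverage x y = hammingAverage y x := by
  simp only [hammingAverage, dist_comm]

theorem hammingAverage_triangle (x y z : V → X) :
    hammingAverage x z ≤ hammingAverage x y + hammingAverage y z := by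
  rw [hammingAverage, hammingAverage, hammingAverage, ← add_div, ← Finset.sum_add_distrib]
  exact div_le_div_of_nonneg_right
    (Finset.sum_le_sum fun v _ => dist_triangle _ _ _) (by positivity)

/-- Needed because `σ n 1` is not assumed to be the identity permutation. -/
theorem hammingAverage_comp_equiv (σ : Equiv.Perm V) (x y : V → X) :
    hammingAverage (fun v => x (σ v)) (fun v => y (σ v)) = hammingAverage x y := by
  rw [hammingAverage, hammingAverage, Equiv.sum_comp σ fun v => dist (x v) (y v)]

theorem continuous_hammingAverage_right (x : V → X) : Continuous fun y => hammingAverage x y :=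
  (continuous_finsetSum _ fun v _ => continuous_const.dist (continuous_apply v)).div_const _

theorem measurableSet_hammingAverage_nhds [CompactSpace X] [MeasurableSpace X] [BorelSpace X]
    (F : Finset (V → X)) (δ : ℝ) :
    MeasurableSet {y | ∃ x ∈ F, hammingAverage x y < δ} := by
  have : {y | ∃ x ∈ F, hammingAverage x y < δ} = ⋃ x ∈ F, {y | hammingAverage x y < δ} := by
    ext; simp
  rw [this]
  exact (isOpen_biUnion fun x _ =>
    isOpen_lt (continuous_hammingAverage_right x) continuous_const).measurableSet

end Hamming

/-! ### Approximate determination and comparison of covering numbers -/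

section Covering

/-- If the `X`-coordinate at the identity is almost surely a function of the `Y`-coordinates,
then it depends on finitely many of them in an approximately continuous way. -/
theorem exists_isOpen_approx_dependsOn {G X Y : Type*} [Group G] [Countable G]
    [MetricSpace X] [CompactSpace X] [MeasurableSpace X] [BorelSpace X]
    [MetricSpace Y] [CompactSpace Y] [MeasurableSpace Y] [BorelSpace Y]
    (l : ProbabilityMeasure (G → X × Y)) {ψ : (G → Y) → X} (hψ : Measurable ψ)
    (hl : ∀ᵐ z ∂(l : Measure (G → X × Y)), (z 1).1 = ψ fun g => (z g).2)
    {η : ℝ} (hη : 0 < η) :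
    ∃ (W : Set (G → X × Y)) (D : Finset G) (r : ℝ), IsOpen W ∧ 0 < r ∧
      (l : Measure (G → X × Y)) Wᶜ < ENNReal.ofReal η ∧
      ∀ z ∈ W, ∀ z' ∈ W, (∀ g ∈ D, dist (z g).2 (z' g).2 < r) → dist (z 1).1 (z' 1).1 < η := by
  have hsnd : Continuous fun (z : G → X × Y) g => (z g).2 := by fun_prop
  have hA : MeasurableSet {z : G → X × Y | (z 1).1 = ψ fun g => (z g).2} :=
    measurableSet_eq_fun (by fun_prop) (hψ.comp hsnd.measurable)
  obtain ⟨K, hKA, hK, hlK⟩ := hA.exists_isClosed_sdiff_lt (μ := (l : Measure (G → X × Y)))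
    (measure_ne_top _ _) (ε := ENNReal.ofReal η) (by simpa using hη)
  have hlK' : (l : Measure (G → X × Y)) Kᶜ < ENNReal.ofReal η := by
    refine (measure_mono_ae ?_).trans_lt hlK
    filter_upwards [hl] with z hz hzK using ⟨hz, hzK⟩
  -- On `K` the `X`-coordinate is exactly `ψ` of the `Y`-coordinates, so the compact projection of
  -- `C` misses the diagonal; its complement is an entourage.
  let C : Set ((G → X × Y) × (G → X × Y)) :=
    (K ×ˢ K) ∩ {p | η / 3 ≤ dist (p.1 1).1 (p.2 1).1}
  have hC : IsCompact C := ((hK.prod hK).inter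
    (isClosed_le continuous_const (by fun_prop))).isCompact
  let π : (G → X × Y) × (G → X × Y) → (G → Y) × (G → Y) :=
    fun p => (fun g => (p.1 g).2, fun g => (p.2 g).2)
  have hπC : IsClosed (π '' C) := (hC.image (by fun_prop)).isClosed
  have hU : (π '' C)ᶜ ∈ uniformity (G → Y) := by
    rw [← nhdsSet_diagonal_eq_uniformity]
    refine hπC.isOpen_compl.mem_nhdsSet.2 ?_
    rintro ⟨y, y'⟩ hy ⟨⟨z, z'⟩, ⟨⟨hz, hz'⟩, hd⟩, hp⟩
    have h1 : (fun g => (z g).2) = y := congrArg Prod.fst hp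
    have h2 : (fun g => (z' g).2) = y' := congrArg Prod.snd hp
    have hy : y = y' := hy
    have e1 : (z 1).1 = ψ y := h1 ▸ hKA hz
    have e2 : (z' 1).1 = ψ y' := h2 ▸ hKA hz'
    have hd : η / 3 ≤ dist (z 1).1 (z' 1).1 := hd
    rw [e1, e2, hy, dist_self] at hd
    linarith
  obtain ⟨D, r, hr, hD⟩ := exists_finset_of_mem_uniformity_pi hU
  -- `K` is enlarged to an open set so that the mass bound survives weak* perturbation. Two triangle
  -- inequalities use up the thirds of `η` and `r`.
  let N : (G → X × Y) → Set (G → X × Y) := fun k =>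
    {z | dist (z 1).1 (k 1).1 < η / 3} ∩ ⋂ g ∈ D, {z | dist (z g).2 (k g).2 < r / 3}
  have hN : ∀ k, IsOpen (N k) := fun k =>
    (isOpen_lt (by fun_prop) continuous_const).inter
      (isOpen_biInter_finset fun g _ => isOpen_lt (by fun_prop) continuous_const)
  refine ⟨⋃ k ∈ K, N k, D, r / 3, isOpen_biUnion fun k _ => hN k, by positivity, ?_, ?_⟩
  · refine (measure_mono (Set.compl_subset_compl.2 fun z hz => ?_)).trans_lt hlK'
    refine Set.mem_biUnion hz ⟨?_, Set.mem_iInter₂.2 fun g _ => ?_⟩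
    · simpa using hη
    · simpa using hr
  · intro z hz z' hz' hzz
    obtain ⟨k, hk, hzk, hzk2⟩ := Set.mem_iUnion₂.1 hz
    obtain ⟨k', hk', hzk', hzk2'⟩ := Set.mem_iUnion₂.1 hz'
    have hkk : dist (k 1).1 (k' 1).1 < η / 3 := by
      by_contra hcon
      refine hD (fun g => (k g).2) (fun g => (k' g).2) (fun g hg => ?_)
        ⟨(k, k'), ⟨⟨hk, hk'⟩, not_lt.1 hcon⟩, rfl⟩
      have h1 : dist (z g).2 (k g).2 < r / 3 := Set.mem_iInter₂.1 hzk2 g hg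
      have h2 : dist (z' g).2 (k' g).2 < r / 3 := Set.mem_iInter₂.1 hzk2' g hg
      have h3 := dist_triangle4 (k g).2 (z g).2 (z' g).2 (k' g).2
      rw [dist_comm (k g).2 (z g).2] at h3
      linarith [hzz g hg]
    have h1 : dist (z 1).1 (k 1).1 < η / 3 := hzk
    have h2 : dist (z' 1).1 (k' 1).1 < η / 3 := hzk'
    have h3 := dist_triangle4 (z 1).1 (k 1).1 (k' 1).1 (z' 1).1
    rw [dist_comm (k' 1).1] at h3
    linarith

theorem toReal_empiricalDistribution_apply {G V X : Type*} [Fintype V] [Nonempty V]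
    [MeasurableSpace X] (σ : G → Equiv.Perm V) (x : V → X) {A : Set (G → X)}
    (hA : MeasurableSet A) :
    (empiricalDistribution σ x : Measure (G → X)).real A =
      (∑ v, A.indicator (fun _ => (1 : ℝ)) (pullbackName σ v x)) / Fintype.card V := by
  rw [← integral_empiricalDistribution σ x (stronglyMeasurable_const.indicator hA)]
  simp [integral_indicator hA, Measure.real]

/-- Each centre near some point of `p '' H` is replaced by one preimage in `H`. Two points of `H`
whose images are near the same centre are `δ`-close, and discarding `Hᶜ` costs `ε / 2`. -/
theorem covNumber_le_covNumber_map {V X Y : Type*} [Fintype V]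
    [MetricSpace X] [MeasurableSpace X]
    [MetricSpace Y] [CompactSpace Y] [MeasurableSpace Y] [BorelSpace Y]
    {μ : ProbabilityMeasure (V → X)}
    {p : (V → X) → (V → Y)} (hp : Measurable p) {H : Set (V → X)} {ε δ δ' : ℝ}
    (hH : (μ : Measure (V → X)) Hᶜ < ENNReal.ofReal (ε / 2))
    (hclose : ∀ x ∈ H, ∀ x' ∈ H, hammingAverage (p x) (p x') < 2 * δ' →
      hammingAverage x x' < δ) :
    covNumber ε δ μ hammingAverage ≤
      covNumber (ε / 2) δ' (μ.map hp.aemeasurable) hammingAverage := by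
  classical
  obtain ⟨x₀⟩ : Nonempty (V → X) := (μ : Measure (V → X)).nonempty_of_neZero
  refine le_iInf₂ fun F hF => ?_
  -- Centres near no image of `H` get the irrelevant default `x₀`.
  let c : (V → Y) → (V → X) := fun y =>
    if h : ∃ x ∈ H, hammingAverage y (p x) < δ' then h.choose else x₀
  refine (iInf₂_le (F.image c) ?_).trans (Nat.cast_le.2 Finset.card_image_le)
  have hsub : p ⁻¹' {y | ∃ x ∈ F, hammingAverage x y < δ'} ⊆
      {y | ∃ x ∈ F.image c, hammingAverage x y < δ} ∪ Hᶜ := by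
    rintro x ⟨y, hyF, hyx⟩
    by_cases hx : x ∈ H
    · refine .inl ⟨c y, Finset.mem_image_of_mem c hyF, ?_⟩
      have h : ∃ x ∈ H, hammingAverage y (p x) < δ' := ⟨x, hx, hyx⟩
      have hc : c y = h.choose := dif_pos h
      rw [hc]
      refine hclose _ h.choose_spec.1 _ hx ?_
      have h1 := hammingAverage_triangle (p h.choose) y (p x)
      rw [hammingAverage_comm (p h.choose) y] at h1
      linarith [h.choose_spec.2]
    · exact .inr hx
  have h1 : (μ.map hp.aemeasurable : ProbabilityMeasure (V → Y)).toMeasure.real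
      {y | ∃ x ∈ F, hammingAverage x y < δ'} =
      (μ : Measure (V → X)).real (p ⁻¹' {y | ∃ x ∈ F, hammingAverage x y < δ'}) :=
    map_measureReal_apply hp (measurableSet_hammingAverage_nhds F δ')
  have h2 : (μ : Measure (V → X)).real Hᶜ < ε / 2 :=
    (ENNReal.lt_ofReal_iff_toReal_lt (measure_ne_top _ _)).1 hH
  have h3 := (measureReal_mono (μ := (μ : Measure (V → X))) hsub).trans
    (measureReal_union_le _ _)
  rw [h1] at hF
  linarith

variable {G X Y : Type*} [Group G] [Countable G]
  [MetricSpace X] [CompactSpace X] [MeasurableSpace X] [BorelSpace X]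
  [MetricSpace Y] [CompactSpace Y] [MeasurableSpace Y] [BorelSpace Y]

/-- At each vertex either `hWD` applies or the distance is at most `M`. The exceptional vertices are
counted by the two indicators of `Wᶜ` and, as in Markov's inequality, by the sum of `Y`-distances
over `D` divided by `r`. Each `σ g` permutes `V`, so averaging that sum gives `D.card` times the
Hamming average. -/
theorem hammingAverage_fst_le {V : Type*} [Fintype V] [Nonempty V] {σ : G → Equiv.Perm V}
    {W : Set (G → X × Y)} (hW : IsOpen W) {D : Finset G} {r η M : ℝ} (hr : 0 < r) (hη : 0 < η)
    (hM : ∀ x x' : X, dist x x' ≤ M)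
    (hWD : ∀ z ∈ W, ∀ z' ∈ W, (∀ g ∈ D, dist (z g).2 (z' g).2 < r) →
      dist (z 1).1 (z' 1).1 < η) (z z' : V → X × Y) :
    hammingAverage (fun v => (z v).1) (fun v => (z' v).1) ≤
      η + M * ((empiricalDistribution σ z : Measure (G → X × Y)).real Wᶜ +
        (empiricalDistribution σ z' : Measure (G → X × Y)).real Wᶜ +
        D.card / r * hammingAverage (fun v => (z v).2) (fun v => (z' v).2)) := by
  have hM0 : 0 ≤ M :=
    dist_nonneg.trans (hM (z (Classical.arbitrary V)).1 (z (Classical.arbitrary V)).1)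
  have hc : (0 : ℝ) < Fintype.card V := by simp [Fintype.card_pos]
  let a : (V → X × Y) → V → ℝ := fun z v =>
    Wᶜ.indicator (fun _ => (1 : ℝ)) (pullbackName σ v z)
  have ha : ∀ z v, 0 ≤ a z v := fun z v => Set.indicator_nonneg (fun _ _ => zero_le_one) _
  let b : V → ℝ := fun v => ∑ g ∈ D, dist (z (σ g v)).2 (z' (σ g v)).2
  have hb : ∀ v, 0 ≤ b v := fun v => Finset.sum_nonneg fun _ _ => dist_nonneg
  have hpt : ∀ v, dist (z (σ 1 v)).1 (z' (σ 1 v)).1 ≤ η + M * (a z v + a z' v + b v / r) := by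
    intro v
    have hbr : 0 ≤ b v / r := div_nonneg (hb v) hr.le
    by_cases h1 : pullbackName σ v z ∈ W
    · by_cases h2 : pullbackName σ v z' ∈ W
      · by_cases h3 : ∀ g ∈ D, dist (z (σ g v)).2 (z' (σ g v)).2 < r
        · have := hWD _ h1 _ h2 h3
          have h4 : 0 ≤ M * (a z v + a z' v + b v / r) :=
            mul_nonneg hM0 (add_nonneg (add_nonneg (ha _ _) (ha _ _)) hbr)
          exact this.le.trans (by linarith)
        · push Not at h3
          obtain ⟨g, hg, hgr⟩ := h3
          have h4 : r ≤ b v := hgr.trans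
            (Finset.single_le_sum (f := fun g => dist (z (σ g v)).2 (z' (σ g v)).2)
              (fun _ _ => dist_nonneg) hg)
          have h5 : 1 ≤ b v / r := (one_le_div hr).2 h4
          have h6 : M * 1 ≤ M * (a z v + a z' v + b v / r) :=
            mul_le_mul_of_nonneg_left (by linarith [ha z v, ha z' v]) hM0
          linarith [hM (z (σ 1 v)).1 (z' (σ 1 v)).1]
      · have h5 : a z' v = 1 := Set.indicator_of_mem (show _ ∈ Wᶜ from h2) _
        have h6 : M * 1 ≤ M * (a z v + a z' v + b v / r) :=
          mul_le_mul_of_nonneg_left (by linarith [ha z v]) hM0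
        linarith [hM (z (σ 1 v)).1 (z' (σ 1 v)).1]
    · have h5 : a z v = 1 := Set.indicator_of_mem (show _ ∈ Wᶜ from h1) _
      have h6 : M * 1 ≤ M * (a z v + a z' v + b v / r) :=
        mul_le_mul_of_nonneg_left (by linarith [ha z' v]) hM0
      linarith [hM (z (σ 1 v)).1 (z' (σ 1 v)).1]
  have hsum : ∑ v, b v =
      D.card * (hammingAverage (fun v => (z v).2) (fun v => (z' v).2) * Fintype.card V) := by
    simp only [b]
    rw [Finset.sum_comm, hammingAverage, div_mul_cancel₀ _ hc.ne', ← nsmul_eq_mul,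
      ← Finset.sum_const]
    exact Finset.sum_congr rfl fun g _ =>
      Equiv.sum_comp (σ g) fun v => dist (z v).2 (z' v).2
  rw [← hammingAverage_comp_equiv (σ 1), hammingAverage, div_le_iff₀ hc,
    toReal_empiricalDistribution_apply _ _ hW.measurableSet.compl,
    toReal_empiricalDistribution_apply _ _ hW.measurableSet.compl]
  refine (Finset.sum_le_sum fun v _ => hpt v).trans_eq ?_
  rw [Finset.sum_add_distrib, ← Finset.mul_sum, Finset.sum_add_distrib, Finset.sum_add_distrib,
    ← Finset.sum_div, hsum, Finset.sum_const, Finset.card_univ, nsmul_eq_mul]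
  simp only [a]
  field_simp

/-- Covering growth does not decrease under images which asymptotically determine the original
points. -/
theorem QuenchedConverges.coveringGrowth_le {S : SoficApproximation G}
    {μs : ∀ n, ProbabilityMeasure (S.V n → X)}
    {q : ∀ n, (S.V n → X) → (S.V n → X × Y)} (hq : ∀ n, Measurable (q n))
    (hq' : ∀ n x x', hammingAverage (fun v => (q n x v).1) (fun v => (q n x' v).1) =
      hammingAverage x x')
    {l : ProbabilityMeasure (G → X × Y)} {ψ : (G → Y) → X} (hψ : Measurable ψ)
    (hl : ∀ᵐ z ∂(l : Measure (G → X × Y)), (z 1).1 = ψ fun g => (z g).2)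
    (h : QuenchedConverges S (fun n => (μs n).map (hq n).aemeasurable) l)
    {p : ∀ n, (S.V n → X) → (S.V n → Y)} (hp : ∀ n, Measurable (p n))
    (hpq : ∀ n x v, p n x v = (q n x v).2) :
    coveringGrowth S μs ≤ coveringGrowth S fun n => (μs n).map (hp n).aemeasurable := by
  refine iSup₂_le fun δ hδ => iSup₂_le fun ε hε => ?_
  obtain ⟨M, hM0, hM⟩ : ∃ M : ℝ, 0 ≤ M ∧ ∀ x x' : X, dist x x' ≤ M :=
    ⟨Metric.diam (Set.univ : Set X), Metric.diam_nonneg, fun x x' =>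
      Metric.dist_le_diam_of_mem isCompact_univ.isBounded (Set.mem_univ _) (Set.mem_univ _)⟩
  -- The final estimate is `η + M * (η + η + η)`, which this makes `δ / 2`.
  let η : ℝ := δ / (2 * (1 + 3 * M))
  have hη : 0 < η := by positivity
  have hηδ : η * (1 + 3 * M) < δ := by
    have : η * (1 + 3 * M) = δ / 2 := by simp only [η]; field_simp
    linarith
  obtain ⟨W, D, r, hW, hr, hlW, hWD⟩ := exists_isOpen_approx_dependsOn l hψ hl hη
  -- Makes the `Y`-distance term at radius `2 * δ'` at most `η`; the `+ 1` covers empty `D`.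
  let δ' : ℝ := η * r / (2 * (D.card + 1))
  have hδ' : 0 < δ' := by positivity
  have hδη : D.card / r * (2 * δ') ≤ η := by
    have : D.card / r * (2 * δ') = η * (D.card / (D.card + 1)) := by
      simp only [δ']; field_simp
    rw [this]
    refine mul_le_of_le_one_right hη.le ((div_le_one (by positivity)).2 (by linarith))
  have hO : ∀ᶠ θ : ProbabilityMeasure (G → X × Y) in 𝓝 l,
      (θ : Measure (G → X × Y)) Wᶜ < ENNReal.ofReal η :=
    eventually_lt_of_limsup_lt
      ((ProbabilityMeasure.limsup_measure_closed_le_of_tendsto tendsto_id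
        hW.isClosed_compl).trans_lt hlW)
  have hH := eventually_highProbabilityFilter.1
    (((quenchedConverges_map_iff hq).1 h).2.eventually hO)
  have hH' := hH.eventually_lt_const (u := ENNReal.ofReal (ε / 2)) (by simpa using hε)
  -- Neither `δ'` nor `ε / 2` depends on `n`, so the comparison passes to the limsup.
  refine le_trans (limsup_le_limsup ?_) (le_iSup₂_of_le δ' hδ' (le_iSup₂_of_le (ε / 2)
    (half_pos hε) le_rfl))
  filter_upwards [hH'] with n hn
  refine EReal.div_le_div_right_of_nonneg (by positivity)
    (ENNReal.log_le_log (ENat.toENNReal_le.2 ?_))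
  refine covNumber_le_covNumber_map (hp n) (H := {x |
    (empiricalDistribution (S.σ n) (q n x) : Measure (G → X × Y)) Wᶜ < ENNReal.ofReal η})
    hn fun x hx x' hx' hxx => ?_
  have h1 : (empiricalDistribution (S.σ n) (q n x) : Measure (G → X × Y)).real Wᶜ < η :=
    (ENNReal.lt_ofReal_iff_toReal_lt (measure_ne_top _ _)).1 hx
  have h2 : (empiricalDistribution (S.σ n) (q n x') : Measure (G → X × Y)).real Wᶜ < η :=
    (ENNReal.lt_ofReal_iff_toReal_lt (measure_ne_top _ _)).1 hx'
  have h3 := hammingAverage_fst_le (σ := S.σ n) hW hr hη hM hWD (q n x) (q n x')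
  simp only [hq', ← hpq] at h3
  have h4 : D.card / r * hammingAverage (p n x) (p n x') ≤ η :=
    (mul_le_mul_of_nonneg_left hxx.le (by positivity)).trans hδη
  have h5 : M * ((empiricalDistribution (S.σ n) (q n x) : Measure (G → X × Y)).real Wᶜ +
      (empiricalDistribution (S.σ n) (q n x') : Measure (G → X × Y)).real Wᶜ +
      D.card / r * hammingAverage (p n x) (p n x')) ≤ M * (η + η + η) :=
    mul_le_mul_of_nonneg_left (by linarith) hM0
  have h6 : hammingAverage x x' ≤ η * (1 + 3 * M) := by
    refine h3.trans ?_
    linarith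
  exact h6.trans_lt hηδ

end Covering

/-! ### Products of measures on function spaces -/

section Pairs

variable {I J X Y Z W : Type*} [MeasurableSpace X] [MeasurableSpace Y] [MeasurableSpace Z]
  [MeasurableSpace W]

theorem measurable_zipFun :
    Measurable fun (p : (I → X) × (I → Y)) i => (p.1 i, p.2 i) := by fun_prop

theorem measurable_pairMap {a : (I → X) → (J → Z)} {b : (I → Y) → (J → W)} (ha : Measurable a)
    (hb : Measurable b) :
    Measurable fun (w : I → X × Y) j => (a (fun i => (w i).1) j, b (fun i => (w i).2) j) :=
  measurable_zipFun.comp ((ha.comp (by fun_prop)).prodMk (hb.comp (by fun_prop)))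

theorem map_prodOnPairs (μ : ProbabilityMeasure (I → X)) (ν : ProbabilityMeasure (I → Y))
    {a : (I → X) → (J → Z)} {b : (I → Y) → (J → W)} (ha : Measurable a) (hb : Measurable b) :
    (prodOnPairs μ ν).map (measurable_pairMap ha hb).aemeasurable =
      prodOnPairs (μ.map ha.aemeasurable) (ν.map hb.aemeasurable) := by
  refine Subtype.ext ?_
  change ((((μ : Measure (I → X)).prod (ν : Measure (I → Y))).map _).map _) =
    (((μ : Measure (I → X)).map a).prod ((ν : Measure (I → Y)).map b)).map _
  rw [Measure.map_map (measurable_pairMap ha hb) measurable_zipFun, Measure.map_prod_map _ _ ha hb,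
    Measure.map_map measurable_zipFun (ha.prodMap hb)]
  rfl

theorem measurePreserving_fst_prodOnPairs (μ : ProbabilityMeasure (I → X))
    (ν : ProbabilityMeasure (I → Y)) :
    MeasurePreserving (fun (w : I → X × Y) i => (w i).1)
      (prodOnPairs μ ν : Measure (I → X × Y)) (μ : Measure (I → X)) := by
  refine ⟨by fun_prop, ?_⟩
  change ((((μ : Measure (I → X)).prod (ν : Measure (I → Y))).map _).map _) = _
  rw [Measure.map_map (by fun_prop) measurable_zipFun]
  exact measurePreserving_fst.map_eq

theorem measurePreserving_snd_prodOnPairs (μ : ProbabilityMeasure (I → X))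
    (ν : ProbabilityMeasure (I → Y)) :
    MeasurePreserving (fun (w : I → X × Y) i => (w i).2)
      (prodOnPairs μ ν : Measure (I → X × Y)) (ν : Measure (I → Y)) := by
  refine ⟨by fun_prop, ?_⟩
  change ((((μ : Measure (I → X)).prod (ν : Measure (I → Y))).map _).map _) = _
  rw [Measure.map_map (by fun_prop) measurable_zipFun]
  exact measurePreserving_snd.map_eq

theorem IsGProcess.prodOnPairs {G : Type*} [Group G] {μ : ProbabilityMeasure (G → X)}
    {ν : ProbabilityMeasure (G → Y)} (hμ : IsGProcess μ) (hν : IsGProcess ν) :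
    IsGProcess (_root_.prodOnPairs μ ν) := by
  intro g
  refine ⟨measurable_rightShift g, ?_⟩
  have h := map_prodOnPairs μ ν (measurable_rightShift (X := X) g)
    (measurable_rightShift (X := Y) g)
  have h1 : μ.map (measurable_rightShift (X := X) g).aemeasurable = μ :=
    Subtype.ext (hμ g).map_eq
  have h2 : ν.map (measurable_rightShift (X := Y) g).aemeasurable = ν :=
    Subtype.ext (hν g).map_eq
  rw [h1, h2] at h
  exact congrArg Subtype.val h

end Pairs

/-! ### Tame maps under pairing and coordinatewise composition -/

section Tame

variable {G X Y : Type*} [TopologicalSpace X] [MeasurableSpace X] [TopologicalSpace Y]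
  [MeasurableSpace Y]

theorem isTame_apply {μ : Measure (G → X)} (g : G) : IsTame μ fun x => x g :=
  ⟨measurable_pi_apply g, ⟨{g}, fun _ _ h => h g (by simp)⟩,
    .of_forall fun _ => (continuous_apply g).continuousAt⟩

theorem IsTame.prodMk {Z : Type*} [TopologicalSpace Z] [MeasurableSpace Z]
    {μ : Measure (G → X)} {f : (G → X) → Y} {f' : (G → X) → Z} (hf : IsTame μ f)
    (hf' : IsTame μ f') : IsTame μ fun x => (f x, f' x) := by
  classical
  obtain ⟨D, hD⟩ := hf.dependsOn
  obtain ⟨E, hE⟩ := hf'.dependsOn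
  refine ⟨hf.measurable.prodMk hf'.measurable, ⟨D ∪ E, fun x y h => ?_⟩, ?_⟩
  · exact Prod.ext (hD fun i hi => h i (by simp_all)) (hE fun i hi => h i (by simp_all))
  · filter_upwards [hf.continuousAt, hf'.continuousAt] with x h h' using h.prodMk h'

theorem IsTame.comp_coordinatewise {Z : Type*} [TopologicalSpace Z] [MeasurableSpace Z]
    {μ : Measure (G → X)} {ν : Measure (G → Z)} {f : (G → X) → Y} (hf : IsTame μ f)
    {c : Z → X} (hc : Continuous c) (hcν : MeasurePreserving (fun (z : G → Z) g => c (z g)) ν μ) :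
    IsTame ν fun z => f fun g => c (z g) := by
  obtain ⟨D, hD⟩ := hf.dependsOn
  refine ⟨hf.measurable.comp hcν.measurable, ⟨D, fun x y h => hD fun i hi => ?_⟩, ?_⟩
  · exact congrArg c (h i hi)
  · have hcont : Continuous fun (z : G → Z) g => c (z g) := by fun_prop
    filter_upwards [hcν.quasiMeasurePreserving.ae hf.continuousAt] with z hz
    exact ContinuousAt.comp (f := fun (z : G → Z) g => c (z g)) hz hcont.continuousAt

end Tame

/-! ### Continuous maps applied coordinatewise -/

section Coordinatewise

variable {G X Y : Type*} [MeasurableSpace X] [MeasurableSpace Y]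

theorem measurable_coordinatewise {I : Type*} {c : X → Y} (hc : Measurable c) :
    Measurable fun (x : I → X) i => c (x i) := by fun_prop

theorem map_empiricalDistribution {V : Type*} [Fintype V] [Nonempty V] (σ : G → Equiv.Perm V)
    (x : V → X) {c : X → Y} (hc : Measurable c) :
    (empiricalDistribution σ x).map (measurable_coordinatewise (I := G) hc).aemeasurable =
      empiricalDistribution σ fun v => c (x v) := by
  refine Subtype.ext ?_
  change ((Fintype.card V : ℝ≥0∞)⁻¹ • ∑ v : V, Measure.dirac (pullbackName σ v x)).map _ =
    (Fintype.card V : ℝ≥0∞)⁻¹ • ∑ v : V, Measure.dirac (pullbackName σ v fun v => c (x v))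
  rw [Measure.map_smul, ← Measure.mapₗ_apply_of_measurable (measurable_coordinatewise hc), map_sum]
  congr 1
  refine Finset.sum_congr rfl fun v _ => ?_
  rw [Measure.mapₗ_apply_of_measurable (measurable_coordinatewise hc),
    Measure.map_dirac' (measurable_coordinatewise hc)]
  rfl

/-- Quenched convergence is preserved by continuous maps applied to every coordinate. -/
theorem QuenchedConverges.map_coordinatewise [Group G] [Countable G]
    [TopologicalSpace X] [SecondCountableTopology X] [BorelSpace X]
    [TopologicalSpace.PseudoMetrizableSpace X]
    [TopologicalSpace Y] [SecondCountableTopology Y] [BorelSpace Y]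
    [TopologicalSpace.PseudoMetrizableSpace Y]
    {S : SoficApproximation G} {μs : ∀ n, ProbabilityMeasure (S.V n → X)}
    {μ : ProbabilityMeasure (G → X)} (h : QuenchedConverges S μs μ) {c : X → Y}
    (hc : Continuous c) :
    QuenchedConverges S
      (fun n => (μs n).map (measurable_coordinatewise hc.measurable).aemeasurable)
      (μ.map (measurable_coordinatewise hc.measurable).aemeasurable) := by
  have hcont := ProbabilityMeasure.continuous_map
    (show Continuous fun (x : G → X) g => c (x g) by fun_prop)
  rw [quenchedConverges_iff] at h
  rw [quenchedConverges_map_iff fun n => measurable_coordinatewise hc.measurable]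
  -- Coordinatewise maps commute exactly with pullback names, so multiplicativity plays no role.
  refine ⟨((hcont.tendsto μ).comp h.1).congr fun p => Subtype.ext ?_,
    ((hcont.tendsto μ).comp h.2).congr fun p => ?_⟩
  · exact Measure.map_map (measurable_coordinatewise hc.measurable) (measurable_pullbackName _ _)
  · exact map_empiricalDistribution _ _ hc.measurable

end Coordinatewise

/-! ### Transport of models through an isomorphism -/

section Isomorphism

variable {G X Y : Type*} [Group G] [Countable G]
  [MetricSpace X] [CompactSpace X] [MeasurableSpace X] [BorelSpace X]
  [MetricSpace Y] [CompactSpace Y] [MeasurableSpace Y] [BorelSpace Y]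

/-- `τ'` pairs the identity coordinates of `x` and `Φ x`. Keeping `x 1` exact in every `τ m` retains
the original model, and `ψ`, the identity coordinate of the inverse, recovers it in the limit. -/
theorem exists_seq_isTame_graph {μ : ProbabilityMeasure (G → X)} {ν : ProbabilityMeasure (G → Y)}
    (hiso : ProcessesIsomorphic μ ν) :
    ∃ (τ : ℕ → (G → X) → X × Y) (τ' : (G → X) → X × Y) (hτ' : Measurable τ') (ψ : (G → Y) → X),
      (∀ m, IsTame (μ : Measure (G → X)) (τ m)) ∧ (∀ m x, (τ m x).1 = x 1) ∧
      (∀ᵐ x ∂(μ : Measure (G → X)), Tendsto (fun m => τ m x) atTop (𝓝 (τ' x))) ∧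
      Measurable ψ ∧
      (∀ᵐ z ∂((μ.map (measurable_blockMap hτ').aemeasurable : ProbabilityMeasure _) :
        Measure (G → X × Y)), (z 1).1 = ψ fun g => (z g).2) ∧
      (μ.map (measurable_blockMap hτ').aemeasurable).map
        (measurable_coordinatewise (I := G) (measurable_snd (α := X) (β := Y))).aemeasurable
        = ν := by
  obtain ⟨Φ, Ψ, hΦ, hΨ, hΨΦ, -, heq⟩ := hiso
  obtain ⟨y₀⟩ : Nonempty (G → Y) := (ν : Measure (G → Y)).nonempty_of_neZero
  have : Nonempty Y := ⟨y₀ 1⟩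
  have hφ : Measurable fun x => Φ x 1 := (measurable_pi_apply 1).comp hΦ.measurable
  have hψ : Measurable fun y => Ψ y 1 := (measurable_pi_apply 1).comp hΨ.measurable
  obtain ⟨f, hf, hlim⟩ := exists_seq_isTame_tendsto_ae (μ : Measure (G → X)) hφ
  have hτ' : Measurable fun x : G → X => (x 1, Φ x 1) := (measurable_pi_apply 1).prodMk hφ
  -- Almost everywhere equivariance, for all `g` of a countable group at once, rebuilds `Φ` from its
  -- identity coordinate.
  have hsnd : ∀ᵐ x ∂(μ : Measure (G → X)),
      (fun g => (blockMap (fun x => (x 1, Φ x 1)) x g).2) = Φ x := by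
    filter_upwards [ae_all_iff.2 heq] with x hx
    funext g
    change Φ (rightShift g x) 1 = Φ x g
    rw [hx g, rightShift, one_mul]
  refine ⟨fun m x => (x 1, f m x), fun x => (x 1, Φ x 1), hτ', fun y => Ψ y 1,
    fun m => (isTame_apply 1).prodMk (hf m), fun m x => rfl, ?_, hψ, ?_, Subtype.ext ?_⟩
  · filter_upwards [hlim] with x hx using tendsto_const_nhds.prodMk_nhds hx
  · refine (ae_map_iff (measurable_blockMap hτ').aemeasurable
      (measurableSet_eq_fun (by fun_prop) (hψ.comp (by fun_prop)))).2 ?_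
    filter_upwards [hsnd, hΨΦ] with x hx hx'
    change x (1 * 1) = Ψ (fun g => (blockMap (fun x => (x 1, Φ x 1)) x g).2) 1
    rw [hx, hx', one_mul]
  · refine (Measure.map_map (measurable_coordinatewise measurable_snd)
      (measurable_blockMap hτ')).trans ?_
    exact (Measure.map_congr hsnd).trans hΦ.map_eq

theorem coveringGrowth_le_of_modelMap {S : SoficApproximation G}
    {μs : ∀ n, ProbabilityMeasure (S.V n → X)} {τ : ℕ → (G → X) → X × Y}
    (hτ : ∀ m, Measurable (τ m)) (hτ1 : ∀ m x, (τ m x).1 = x 1)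
    {l : ProbabilityMeasure (G → X × Y)} {ψ : (G → Y) → X} (hψ : Measurable ψ)
    (hl : ∀ᵐ z ∂(l : Measure (G → X × Y)), (z 1).1 = ψ fun g => (z g).2)
    (h : QuenchedConverges S
      (fun n => (μs n).map (measurable_modelMap (S.σ n) (hτ n)).aemeasurable) l) :
    coveringGrowth S μs ≤ coveringGrowth S fun n =>
      ((μs n).map (measurable_modelMap (S.σ n) (hτ n)).aemeasurable).map
        (measurable_coordinatewise (measurable_snd (α := X) (β := Y))).aemeasurable := by
  have hmap : ∀ n, ((μs n).map (measurable_modelMap (S.σ n) (hτ n)).aemeasurable).map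
      (measurable_coordinatewise (measurable_snd (α := X) (β := Y))).aemeasurable =
      (μs n).map ((measurable_coordinatewise (I := S.V n)
        (measurable_snd (α := X) (β := Y))).comp
          (measurable_modelMap (S.σ n) (hτ n))).aemeasurable := fun n =>
    Subtype.ext (Measure.map_map (by fun_prop) (measurable_modelMap (S.σ n) (hτ n)))
  simp only [hmap]
  refine h.coveringGrowth_le (fun n => measurable_modelMap (S.σ n) (hτ n)) (fun n x x' => ?_) hψ hl
    (fun n => (measurable_coordinatewise measurable_snd).comp
      (measurable_modelMap (S.σ n) (hτ n))) fun n x v => rfl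
  simp only [modelMap, hτ1]
  exact hammingAverage_comp_equiv (S.σ n 1) x x'

theorem QuenchedConverges.exists_of_processesIsomorphic {S : SoficApproximation G}
    {μs : ∀ n, ProbabilityMeasure (S.V n → X)} {μ : ProbabilityMeasure (G → X)}
    {ν : ProbabilityMeasure (G → Y)} (hμ : IsGProcess μ) (hiso : ProcessesIsomorphic μ ν)
    (h : QuenchedConverges S μs μ) :
    ∃ νs : ∀ n, ProbabilityMeasure (S.V n → Y), QuenchedConverges S νs ν ∧
      coveringGrowth S μs ≤ coveringGrowth S νs := by
  obtain ⟨τ, τ', hτ', ψ, hτ, hτ1, hlim, hψ, hl, hν⟩ := exists_seq_isTame_graph hiso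
  obtain ⟨k, hk⟩ := h.exists_modelMap hμ hτ hτ' hlim
  refine ⟨_, ?_, coveringGrowth_le_of_modelMap (τ := fun n => τ (k n))
    (fun n => (hτ (k n)).measurable) (fun n => hτ1 (k n)) hψ hl hk⟩
  rw [← hν]
  exact hk.map_coordinatewise continuous_snd

/-- Running the diagonal argument on `μ × μ` with `τ m` on both factors gives one index for both, so
the image of `μs n × μs n` is again a square `θ n × θ n`. -/
theorem DoublyQuenchedConverges.exists_of_processesIsomorphic {S : SoficApproximation G}
    {μs : ∀ n, ProbabilityMeasure (S.V n → X)} {μ : ProbabilityMeasure (G → X)}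
    {ν : ProbabilityMeasure (G → Y)} (hμ : IsGProcess μ) (hiso : ProcessesIsomorphic μ ν)
    (h : DoublyQuenchedConverges S μs μ) :
    ∃ νs : ∀ n, ProbabilityMeasure (S.V n → Y), DoublyQuenchedConverges S νs ν ∧
      coveringGrowth S μs ≤ coveringGrowth S νs := by
  obtain ⟨τ, τ', hτ', ψ, hτ, hτ1, hlim, hψ, hl, hν⟩ := exists_seq_isTame_graph hiso
  have hfst := measurePreserving_fst_prodOnPairs μ μ
  have hsnd := measurePreserving_snd_prodOnPairs μ μ
  obtain ⟨k, hk⟩ := QuenchedConverges.exists_modelMap (hμ.prodOnPairs hμ) h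
    (τ := fun m w => (τ m fun g => (w g).1, τ m fun g => (w g).2))
    (fun m => ((hτ m).comp_coordinatewise continuous_fst hfst).prodMk
      ((hτ m).comp_coordinatewise continuous_snd hsnd))
    (τ' := fun w => (τ' fun g => (w g).1, τ' fun g => (w g).2))
    ((hτ'.comp (by fun_prop)).prodMk (hτ'.comp (by fun_prop))) (by
      filter_upwards [hfst.quasiMeasurePreserving.ae hlim,
        hsnd.quasiMeasurePreserving.ae hlim] with w h1 h2 using h1.prodMk_nhds h2)
  let θ : ∀ n, ProbabilityMeasure (S.V n → X × Y) := fun n =>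
    (μs n).map (measurable_modelMap (S.σ n) (hτ (k n)).measurable).aemeasurable
  let l : ProbabilityMeasure (G → X × Y) := μ.map (measurable_blockMap hτ').aemeasurable
  have hdq : QuenchedConverges S (fun n => prodOnPairs (θ n) (θ n)) (prodOnPairs l l) := by
    have h1 : ∀ n, _ = prodOnPairs (θ n) (θ n) := fun n => map_prodOnPairs (μs n) (μs n)
      (measurable_modelMap (S.σ n) (hτ (k n)).measurable)
      (measurable_modelMap (S.σ n) (hτ (k n)).measurable)
    have h2 : _ = prodOnPairs l l := map_prodOnPairs μ μ (measurable_blockMap hτ')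
      (measurable_blockMap hτ')
    rw [← h2, ← show _ = (fun n => prodOnPairs (θ n) (θ n)) from funext h1]
    exact hk
  -- The covering estimate needs only ordinary quenched convergence, read off from a marginal.
  have hq : QuenchedConverges S θ l := by
    have h1 := hdq.map_coordinatewise continuous_fst
    have h2 : ∀ n, (prodOnPairs (θ n) (θ n)).map
          (measurable_coordinatewise (I := S.V n) continuous_fst.measurable).aemeasurable = θ n :=
      fun n => Subtype.ext (measurePreserving_fst_prodOnPairs (θ n) (θ n)).map_eq
    have h3 : (prodOnPairs l l).map
          (measurable_coordinatewise (I := G) continuous_fst.measurable).aemeasurable = l :=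
      Subtype.ext (measurePreserving_fst_prodOnPairs l l).map_eq
    simpa only [h2, h3] using h1
  refine ⟨_, ?_, coveringGrowth_le_of_modelMap (τ := fun n => τ (k n))
    (fun n => (hτ (k n)).measurable) (fun n => hτ1 (k n)) hψ hl hq⟩
  rw [DoublyQuenchedConverges, ← hν]
  have h1 := hdq.map_coordinatewise (c := fun z => (z.1.2, z.2.2)) (by fun_prop)
  have h2 : ∀ n, prodOnPairs
      ((θ n).map (measurable_coordinatewise (measurable_snd (α := X) (β := Y))).aemeasurable)
      ((θ n).map (measurable_coordinatewise (measurable_snd (α := X) (β := Y))).aemeasurable) =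
      _ := fun n => (map_prodOnPairs (θ n) (θ n) (measurable_coordinatewise measurable_snd)
        (measurable_coordinatewise measurable_snd)).symm
  have h3 := map_prodOnPairs l l
    (measurable_coordinatewise (I := G) (measurable_snd (α := X) (β := Y)))
    (measurable_coordinatewise (I := G) (measurable_snd (α := X) (β := Y)))
  rw [← h3]
  exact (funext h2).symm ▸ h1

end Isomorphism

/-! ### Invariance of both entropies -/

section Invariance

variable {G X Y : Type*} [Group G] [MeasurableSpace X] [MeasurableSpace Y]

theorem ProcessesIsomorphic.refl (μ : ProbabilityMeasure (G → X)) : ProcessesIsomorphic μ μ :=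
  ⟨id, id, .id _, .id _, .of_forall fun _ => rfl, .of_forall fun _ => rfl,
    fun _ => .of_forall fun _ => rfl⟩

/-- Equivariance of `Ψ` at `y` follows from that of `Φ` at `Ψ y`, and from `Ψ ∘ Φ = id` at the shift
of `Ψ y`; invariance of `μ` keeps that shifted point off the null set. -/
theorem ProcessesIsomorphic.symm {μ : ProbabilityMeasure (G → X)}
    {ν : ProbabilityMeasure (G → Y)} (hμ : IsGProcess μ) (h : ProcessesIsomorphic μ ν) :
    ProcessesIsomorphic ν μ := by
  obtain ⟨Φ, Ψ, hΦ, hΨ, hΨΦ, hΦΨ, heq⟩ := h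
  refine ⟨Ψ, Φ, hΨ, hΦ, hΦΨ, hΨΦ, fun g => ?_⟩
  filter_upwards [hΦΨ, hΨ.quasiMeasurePreserving.ae (heq g),
    hΨ.quasiMeasurePreserving.ae ((hμ g).quasiMeasurePreserving.ae hΨΦ)] with y h1 h2 h3
  rw [← h3, h2, h1]

variable [Countable G]

theorem quenchedEntropy_le {S : SoficApproximation G} {dX : CompactGeneratingMetric X}
    {dY : CompactGeneratingMetric Y} {μ : ProbabilityMeasure (G → X)}
    {ν : ProbabilityMeasure (G → Y)} (hμ : IsGProcess μ) (h : ProcessesIsomorphic μ ν) :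
    quenchedEntropy S dX μ ≤ quenchedEntropy S dY ν := by
  let _ := dX.toMetricSpace
  have := dX.borelSpace
  have := dX.compactSpace
  let _ := dY.toMetricSpace
  have := dY.borelSpace
  have := dY.compactSpace
  refine iSup₂_le fun n hn => iSup₂_le fun μs hμs => ?_
  obtain ⟨νs, hνs, hle⟩ := hμs.exists_of_processesIsomorphic hμ h
  exact hle.trans (le_iSup₂_of_le n hn (le_iSup₂_of_le νs hνs le_rfl))

theorem doublyQuenchedEntropy_le {S : SoficApproximation G} {dX : CompactGeneratingMetric X}
    {dY : CompactGeneratingMetric Y} {μ : ProbabilityMeasure (G → X)}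
    {ν : ProbabilityMeasure (G → Y)} (hμ : IsGProcess μ) (h : ProcessesIsomorphic μ ν) :
    doublyQuenchedEntropy S dX μ ≤ doublyQuenchedEntropy S dY ν := by
  let _ := dX.toMetricSpace
  have := dX.borelSpace
  have := dX.compactSpace
  let _ := dY.toMetricSpace
  have := dY.borelSpace
  have := dY.compactSpace
  refine iSup₂_le fun n hn => iSup₂_le fun μs hμs => ?_
  obtain ⟨νs, hνs, hle⟩ := hμs.exists_of_processesIsomorphic hμ h
  exact hle.trans (le_iSup₂_of_le n hn (le_iSup₂_of_le νs hνs le_rfl))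

end Invariance

theorem mainTheorem6 {G : Type*} [Group G] [Countable G] (S : SoficApproximation G)
    {X : Type*} [MeasurableSpace X] (dX : CompactGeneratingMetric X)
    (μ : ProbabilityMeasure (G → X)) (hμ : IsGProcess μ) :
    (∀ (Y : Type*) [MeasurableSpace Y] (dY : CompactGeneratingMetric Y)
      (ν : ProbabilityMeasure (G → Y)), IsGProcess ν → ProcessesIsomorphic μ ν →
        quenchedEntropy S dX μ = quenchedEntropy S dY ν ∧
        doublyQuenchedEntropy S dX μ = doublyQuenchedEntropy S dY ν) ∧
    (∀ d' : CompactGeneratingMetric X,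
      quenchedEntropy S dX μ = quenchedEntropy S d' μ ∧
      doublyQuenchedEntropy S dX μ = doublyQuenchedEntropy S d' μ) := by
  refine ⟨fun Y _ dY ν hν h => ⟨?_, ?_⟩, fun d' => ⟨?_, ?_⟩⟩
  · exact le_antisymm (quenchedEntropy_le hμ h) (quenchedEntropy_le hν (h.symm hμ))
  · exact le_antisymm (doublyQuenchedEntropy_le hμ h) (doublyQuenchedEntropy_le hν (h.symm hμ))
  -- A change of metric is the identity isomorphism between two metric processes.
  · exact le_antisymm (quenchedEntropy_le hμ (.refl μ)) (quenchedEntropy_le hμ (.refl μ))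
  · exact le_antisymm (doublyQuenchedEntropy_le hμ (.refl μ))
      (doublyQuenchedEntropy_le hμ (.refl μ))
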